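/- Conventions. Let $G$ be a discrete group with unit $e$. $G$ is amenable if it carries a left-invariant finitely additive probability measure on all of its subsets. A submultiplicative symmetric weight on $G$ is a function $\nu:G\to[1,\infty)$ with $\nu(xy)\le\nu(x)\nu(y)$ and $\nu(x^{-1})=\nu(x)$ for all $x,y\in G$. A twisted $C^*$-dynamical system $(\mathcal A,\alpha,\omega)$ with group $G$ consists of a (not necessarily unital) $C^*$-algebra $\mathcal A$, a map $\alpha:G\to\mathrm{Aut}(\mathcal A)$ into the $*$-automorphisms and a map $\omega:G\times G\to\mathcal U\mathcal M(\mathcal A)$ into the unitary group of the multiplier algebra such that, for all $x,y,z\in G$, $\alpha_x\circ\alpha_y=\mathrm{ad}_{\omega(x,y)}\circ\alpha_{xy}$, $\ \omega(x,y)\,\omega(xy,z)=\alpha_x[\omega(y,z)]\,\omega(x,yz)$ (with $\alpha_x$ extended to $\mathcal M(\mathcal A)$) and $\omega(x,e)=1=\omega(e,x)$. Given such a system and a submultiplicative symmetric weight $\nu$, let $\ell^{1,\nu}_{\alpha,\omega}(G;\mathcal A)$ be the Banach $*$-algebra of all $f:G\to\mathcal A$ with $\|f\|:=\sum_{x}\nu(x)\|f(x)\|_{\mathcal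 A}<\infty$, with product and involution $$(f\diamond g)(x)=\sum_{y\in G}f(y)\,\alpha_y[g(y^{-1}x)]\,\omega(y,y^{-1}x),\qquad f^{\diamond}(x)=\omega(x,x^{-1})^*\,\alpha_x[f(x^{-1})]^*.$$ For $\nu=1$, $\alpha_x=\mathrm{id}$ and $\omega=1$ this is the algebra $\ell^1(G;\mathcal A)\cong\ell^1(G)\widehat\otimes\mathcal A$. A Banach $*$-algebra $\mathcal B$ is symmetric if the spectrum of $b^*b$ (computed in the unitization when $\mathcal B$ has no unit) is contained in $[0,\infty)$ for every $b\in\mathcal B$. $G$ is rigidly symmetric if $\ell^1(G;\mathcal A)$ is symmetric for every $C^*$-algebra $\mathcal A$. Theorem. Let $G$ be a rigidly symmetric amenable discrete group and $\nu$ a submultiplicative symmetric weight on $G$. Assume that there is a subset $V\subseteq G$ containing $e$ which generates $G$ in the sense that $G=\bigcup_{n\ge 0}V^n$, where $V^n=\{x_1\cdots x_n: x_i\in V\}$ and $V^0=\{e\}$, such that 1. $\displaystyle\lim_{n\to\infty}\ \sup_{x_1,\dots,x_n\in V}\nu(x_1\cdots x_n)^{1/n}=1$; 2. there is a finite constant $C$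 such that $\displaystyle\sup_{x\in V^n\setminus V^{n-1}}\nu(x)\le C\inf_{x\in V^n\setminus V^{n-1}}\nu(x)$ for every $n\ge 1$ (nothing being required when $V^n\setminus V^{n-1}=\emptyset$). Then $\ell^{1,\nu}_{\alpha,\omega}(G;\mathcal A)$ is a symmetric Banach $*$-algebra for every twisted $C^*$-dynamical system $(\mathcal A,\alpha,\omega)$ with group $G$. -/

import Mathlib

open Filter Topology
open scoped Pointwise ENNReal NNReal MultiplierAlgebra

/-! ### Groups and weights -/

/-- A discrete group is amenable if it carries a left-invariant finitely additive probability
measure defined on all of its subsets. -/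
def IsAmenableGroup (G : Type*) [Group G] : Prop :=
  ∃ m : Set G → ℝ, (∀ s, 0 ≤ m s) ∧ m Set.univ = 1 ∧
    (∀ s t, Disjoint s t → m (s ∪ t) = m s + m t) ∧ ∀ (g : G) (s : Set G), m (g • s) = m s

/-- A submultiplicative, symmetric weight `ν : G → [1, ∞)`. -/
structure SymmWeight (G : Type*) [Group G] where
  toFun : G → ℝ
  one_le' : ∀ x, 1 ≤ toFun x
  mul_le' : ∀ x y, toFun (x * y) ≤ toFun x * toFun y
  inv' : ∀ x, toFun x⁻¹ = toFun x

instance SymmWeight.instCoeFun (G : Type*) [Group G] : CoeFun (SymmWeight G) (fun _ => G → ℝ) :=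
  ⟨SymmWeight.toFun⟩

/-- The constant weight `1`. -/
def SymmWeight.trivial (G : Type*) [Group G] : SymmWeight G where
  toFun := fun _ => 1
  one_le' := fun _ => le_rfl
  mul_le' := fun _ _ => by norm_num
  inv' := fun _ => rfl

namespace SymmWeight

variable {G : Type*} [Group G] (ν : SymmWeight G)

theorem pos (x : G) : 0 < ν x := lt_of_lt_of_le one_pos (ν.one_le' x)

theorem nonneg (x : G) : 0 ≤ ν x := (ν.pos x).le

end SymmWeight

/-! ### Multipliers of C*-algebras and twisted C*-dynamical systems -/

noncomputable section

/-- The extension of a `*`-automorphism `φ` of `A` to the multiplier algebra: the double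
centralizer `(L, R)` is sent to `(φ L φ⁻¹, φ R φ⁻¹)`. -/
def multiplierExtend {A : Type*} [NonUnitalCStarAlgebra A] (φ : A ≃⋆ₐ[ℂ] A) (m : 𝓜(ℂ, A)) :
    𝓜(ℂ, A) where
  fst := LinearMap.mkContinuous
    { toFun := fun a => φ (m.fst (φ.symm a))
      map_add' := fun a b => by simp
      map_smul' := fun c a => by simp } ‖m.fst‖ (fun a => by
        have h1 := NonUnitalStarAlgHom.norm_map φ φ.injective (m.fst (φ.symm a))
        have h2 := NonUnitalStarAlgHom.norm_map φ.symm φ.symm.injective a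
        have h3 := m.fst.le_opNorm (φ.symm a)
        rw [h2] at h3
        exact h1.le.trans h3)
  snd := LinearMap.mkContinuous
    { toFun := fun a => φ (m.snd (φ.symm a))
      map_add' := fun a b => by simp
      map_smul' := fun c a => by simp } ‖m.snd‖ (fun a => by
        have h1 := NonUnitalStarAlgHom.norm_map φ φ.injective (m.snd (φ.symm a))
        have h2 := NonUnitalStarAlgHom.norm_map φ.symm φ.symm.injective a
        have h3 := m.snd.le_opNorm (φ.symm a)
        rw [h2] at h3
        exact h1.le.trans h3)
  central := fun x y => by
    have h := congrArg φ (m.central (φ.symm x) (φ.symm y))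
    simpa using h

/-- A twisted C*-dynamical system `(A, α, ω)` with discrete group `G`; here `A` need not be unital
and the cocycle `ω` takes values in the unitary group of the multiplier algebra of `A`. -/
structure TwistedCStarSystem (G A : Type*) [Group G] [NonUnitalCStarAlgebra A] where
  α : G → (A ≃⋆ₐ[ℂ] A)
  ω : G → G → unitary 𝓜(ℂ, A)
  α_comp : ∀ (x y : G) (a : A), (α x (α y a) : 𝓜(ℂ, A)) =
    (ω x y : 𝓜(ℂ, A)) * (α (x * y) a : 𝓜(ℂ, A)) * star (ω x y : 𝓜(ℂ, A))
  cocycle : ∀ x y z : G, (ω x y : 𝓜(ℂ, A)) * (ω (x * y) z : 𝓜(ℂ, A)) =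
    multiplierExtend (α x) (ω y z) * (ω x (y * z) : 𝓜(ℂ, A))
  ω_one_right : ∀ x : G, ω x 1 = 1
  ω_one_left : ∀ x : G, ω 1 x = 1

namespace MultiplierFacts

variable {A : Type*} [NonUnitalCStarAlgebra A]

theorem eq_of_mul_right {a b : A} (h : ∀ c : A, a * c = b * c) : a = b := by
  have h1 : (a - b) * star (a - b) = 0 := by rw [sub_mul, h, sub_self]
  have h2 : a - b = 0 := (CStarRing.mul_star_self_eq_zero_iff _).1 h1
  exact sub_eq_zero.mp h2

theorem coe_inj {a b : A} (h : (a : 𝓜(ℂ, A)) = (b : 𝓜(ℂ, A))) : a = b := by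
  refine eq_of_mul_right fun c => ?_
  have := congrArg (fun m : 𝓜(ℂ, A) => m.fst c) h
  simpa using this

theorem ext_of_snd {m n : 𝓜(ℂ, A)} (h : ∀ a, m.snd a = n.snd a) : m = n := by
  refine DoubleCentralizer.ext ℂ A m n (Prod.ext ?_ ?_)
  · ext b
    have : ∀ c : A, c * m.fst b = c * n.fst b := fun c => by
      rw [← m.central, ← n.central, h]
    apply star_injective
    refine eq_of_mul_right fun c => ?_
    have := congrArg star (this (star c))
    simpa using this
  · ext b
    exact h b

theorem snd_mul (m : 𝓜(ℂ, A)) (a b : A) : m.snd (a * b) = a * m.snd b := by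
  refine eq_of_mul_right fun c => ?_
  rw [m.central, mul_assoc, mul_assoc, m.central]

/-- `m.snd a` is the product `a m` inside the multiplier algebra. -/
theorem coe_snd_apply (m : 𝓜(ℂ, A)) (a : A) :
    ((m.snd a : A) : 𝓜(ℂ, A)) = (a : 𝓜(ℂ, A)) * m := by
  refine ext_of_snd fun b => ?_
  simp [snd_mul]

theorem coe_mul (a b : A) : ((a * b : A) : 𝓜(ℂ, A)) = (a : 𝓜(ℂ, A)) * (b : 𝓜(ℂ, A)) :=
  map_mul (DoubleCentralizer.coeHom (𝕜 := ℂ) (A := A)) a b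

theorem coe_star (a : A) : ((star a : A) : 𝓜(ℂ, A)) = star (a : 𝓜(ℂ, A)) :=
  map_star (DoubleCentralizer.coeHom (𝕜 := ℂ) (A := A)) a

/-- `m.fst a` is the product `m a` inside the multiplier algebra. -/
theorem coe_fst_apply (m : 𝓜(ℂ, A)) (a : A) :
    ((m.fst a : A) : 𝓜(ℂ, A)) = m * (a : 𝓜(ℂ, A)) := by
  refine ext_of_snd fun b => ?_
  simp [m.central]

theorem extend_coe (φ : A ≃⋆ₐ[ℂ] A) (a : A) :
    multiplierExtend φ (a : 𝓜(ℂ, A)) = ((φ a : A) : 𝓜(ℂ, A)) := by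
  refine ext_of_snd fun b => ?_
  simp [multiplierExtend]

theorem extend_mul (φ : A ≃⋆ₐ[ℂ] A) (m n : 𝓜(ℂ, A)) :
    multiplierExtend φ (m * n) = multiplierExtend φ m * multiplierExtend φ n := by
  refine ext_of_snd fun b => ?_
  simp [multiplierExtend]

theorem extend_one (φ : A ≃⋆ₐ[ℂ] A) :
    multiplierExtend φ (1 : 𝓜(ℂ, A)) = 1 := by
  refine ext_of_snd fun b => ?_
  simp [multiplierExtend]

theorem extend_star (φ : A ≃⋆ₐ[ℂ] A) (m : 𝓜(ℂ, A)) :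
    multiplierExtend φ (star m) = star (multiplierExtend φ m) := by
  refine ext_of_snd fun b => ?_
  simp [multiplierExtend, map_star]

theorem norm_aut (φ : A ≃⋆ₐ[ℂ] A) (a : A) : ‖φ a‖ = ‖a‖ :=
  NonUnitalStarAlgHom.norm_map φ φ.injective a

theorem norm_unitary_le (u : unitary 𝓜(ℂ, A)) : ‖(u : 𝓜(ℂ, A))‖ ≤ 1 := by
  have h := CStarRing.norm_star_mul_self (x := (u : 𝓜(ℂ, A)))
  rw [Unitary.coe_star_mul_self] at h
  have h1 : ‖(1 : 𝓜(ℂ, A))‖ ≤ 1 := by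
    rw [← DoubleCentralizer.norm_snd, DoubleCentralizer.one_snd]
    exact ContinuousLinearMap.norm_id_le
  nlinarith [norm_nonneg (u : 𝓜(ℂ, A))]

theorem norm_snd_le (u : unitary 𝓜(ℂ, A)) (a : A) : ‖(u : 𝓜(ℂ, A)).snd a‖ ≤ ‖a‖ := by
  have h := (u : 𝓜(ℂ, A)).snd.le_opNorm a
  rw [DoubleCentralizer.norm_snd] at h
  nlinarith [norm_nonneg a, norm_unitary_le u]

theorem norm_fst_le (u : unitary 𝓜(ℂ, A)) (a : A) : ‖(u : 𝓜(ℂ, A)).fst a‖ ≤ ‖a‖ := by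
  have h := (u : 𝓜(ℂ, A)).fst.le_opNorm a
  rw [DoubleCentralizer.norm_fst] at h
  nlinarith [norm_nonneg a, norm_unitary_le u]

end MultiplierFacts

/-- The trivial system: identity action and cocycle `1`. -/
def TwistedCStarSystem.trivial (G A : Type*) [Group G] [NonUnitalCStarAlgebra A] :
    TwistedCStarSystem G A where
  α := fun _ => StarAlgEquiv.refl ℂ A
  ω := fun _ _ => 1
  α_comp := fun x y a => by simp
  cocycle := fun x y z => by simp [MultiplierFacts.extend_one]
  ω_one_right := fun _ => rfl
  ω_one_left := fun _ => rfl

/-! ### The weighted twisted crossed product -/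

/-- The functions `f : G → A` with `∑ ν(x) ‖f x‖ < ∞`. -/
def weightedL1 {G : Type*} [Group G] (A : Type*) [NonUnitalCStarAlgebra A] (ν : SymmWeight G) :
    Submodule ℂ (G → A) where
  carrier := {f | Summable fun x => ν x * ‖f x‖}
  zero_mem' := by simp
  add_mem' := fun {f g} hf hg => by
    refine Summable.of_nonneg_of_le (fun x => mul_nonneg (ν.nonneg x) (norm_nonneg _))
      (fun x => ?_) (hf.add hg)
    rw [← mul_add]
    exact mul_le_mul_of_nonneg_left (norm_add_le _ _) (ν.nonneg x)
  smul_mem' := fun c f hf => by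
    refine (hf.mul_left ‖c‖).congr (fun x => ?_)
    simp [norm_smul]
    ring

/-- The weighted twisted crossed product `ℓ^{1,ν}_{α,ω}(G; A)`. -/
structure TwistedCrossedProduct {G A : Type*} [Group G] [NonUnitalCStarAlgebra A]
    (S : TwistedCStarSystem G A) (ν : SymmWeight G) where
  toFun : G → A
  mem' : toFun ∈ weightedL1 A ν

namespace TwistedCrossedProduct

open MultiplierFacts

variable {G A : Type*} [Group G] [NonUnitalCStarAlgebra A]
variable {S : TwistedCStarSystem G A} {ν : SymmWeight G}

/-- The underlying vector space is the space of functions with `∑ ν(x) ‖f x‖ < ∞`, with the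
pointwise operations. -/
def equivL1 : TwistedCrossedProduct S ν ≃ weightedL1 A ν where
  toFun := fun f => ⟨f.toFun, f.mem'⟩
  invFun := fun f => ⟨f.1, f.2⟩
  left_inv := fun _ => rfl
  right_inv := fun _ => rfl

instance instAddCommGroup : AddCommGroup (TwistedCrossedProduct S ν) :=
  (equivL1 (S := S) (ν := ν)).addCommGroup

instance instModule : Module ℂ (TwistedCrossedProduct S ν) :=
  (equivL1 (S := S) (ν := ν)).module ℂ

instance instCoeFun : CoeFun (TwistedCrossedProduct S ν) (fun _ => G → A) :=
  ⟨fun f => f.toFun⟩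

theorem ext {f g : TwistedCrossedProduct S ν} (h : ∀ x, f x = g x) : f = g := by
  cases f
  cases g
  congr
  exact funext h

theorem add_apply (f g : TwistedCrossedProduct S ν) (x : G) : (f + g) x = f x + g x := rfl

theorem neg_apply (f : TwistedCrossedProduct S ν) (x : G) : (-f) x = -f x := rfl

theorem zero_apply (x : G) : (0 : TwistedCrossedProduct S ν) x = 0 := rfl

theorem smul_apply (c : ℂ) (f : TwistedCrossedProduct S ν) (x : G) : (c • f) x = c • f x := rfl

theorem summable_weight (f : TwistedCrossedProduct S ν) : Summable fun x => ν x * ‖f x‖ := f.mem'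

theorem summable_norm (f : TwistedCrossedProduct S ν) : Summable fun x => ‖f x‖ :=
  Summable.of_nonneg_of_le (fun _ => norm_nonneg _)
    (fun x => le_mul_of_one_le_left (norm_nonneg _) (ν.one_le' x)) f.summable_weight

/-- The norm `‖f‖ = ∑ ν(x) ‖f x‖`. -/
instance instNorm : Norm (TwistedCrossedProduct S ν) := ⟨fun f => ∑' x, ν x * ‖f x‖⟩

theorem norm_def (f : TwistedCrossedProduct S ν) : ‖f‖ = ∑' x, ν x * ‖f x‖ := rfl

theorem weight_mul_norm_le (f : TwistedCrossedProduct S ν) (x : G) : ν x * ‖f x‖ ≤ ‖f‖ :=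
  f.summable_weight.le_tsum x fun y _ => mul_nonneg (ν.nonneg y) (norm_nonneg _)

theorem norm_apply_le (f : TwistedCrossedProduct S ν) (x : G) : ‖f x‖ ≤ ‖f‖ :=
  (le_mul_of_one_le_left (norm_nonneg _) (ν.one_le' x)).trans (f.weight_mul_norm_le x)

instance instNormedAddCommGroup : NormedAddCommGroup (TwistedCrossedProduct S ν) :=
  { AddGroupNorm.toNormedAddCommGroup
      { toFun := fun f : TwistedCrossedProduct S ν => ‖f‖
        map_zero' := by simp [norm_def, zero_apply]
        add_le' := fun f g => by
          rw [norm_def, norm_def, norm_def, ← f.summable_weight.tsum_add g.summable_weight]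
          refine (f + g).summable_weight.tsum_le_tsum (fun x => ?_)
            (f.summable_weight.add g.summable_weight)
          rw [← mul_add]
          exact mul_le_mul_of_nonneg_left (norm_add_le _ _) (ν.nonneg x)
        neg' := fun f => by simp [norm_def, neg_apply]
        eq_zero_of_map_eq_zero' := fun f hf => by
          refine ext fun x => ?_
          have h := f.norm_apply_le x
          rw [hf] at h
          exact norm_eq_zero.1 (le_antisymm h (norm_nonneg _)) } with
    toNorm := instNorm
    toAddCommGroup := instAddCommGroup }

instance instNormedSpace : NormedSpace ℂ (TwistedCrossedProduct S ν) where
  norm_smul_le := fun c f => by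
    rw [norm_def, norm_def, ← tsum_mul_left]
    refine le_of_eq (tsum_congr fun x => ?_)
    rw [smul_apply, norm_smul]
    ring

/-- Multiplication by the weight is an isometry onto the unweighted space `ℓ¹(G; A)`. -/
def toLp (f : TwistedCrossedProduct S ν) : lp (fun _ : G => A) 1 :=
  ⟨fun x => (ν x : ℂ) • f x, by
    refine (memℓp_gen_iff (by simp)).2 ?_
    refine f.summable_weight.congr fun x => ?_
    simp [norm_smul, abs_of_pos (ν.pos x)]⟩

theorem norm_toLp (f : TwistedCrossedProduct S ν) : ‖f.toLp‖ = ‖f‖ := by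
  rw [lp.norm_eq_tsum_rpow (by simp), norm_def]
  simp [toLp, norm_smul, abs_of_pos (ν.pos _)]

instance instCompleteSpace : CompleteSpace (TwistedCrossedProduct S ν) := by
  let Φ : TwistedCrossedProduct S ν →+ lp (fun _ : G => A) 1 :=
    { toFun := toLp
      map_zero' := by
        ext x
        simp [toLp, zero_apply]
      map_add' := fun f g => by
        ext x
        exact smul_add _ _ _ }
  have hΦ : Isometry Φ := AddMonoidHomClass.isometry_of_norm Φ norm_toLp
  have hsurj : Function.Surjective Φ := fun g => by
    have hg := (memℓp_gen_iff (p := 1) (by simp)).1 g.2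
    refine ⟨⟨fun x => (ν x : ℂ)⁻¹ • g x, ?_⟩, ?_⟩
    · refine hg.congr fun x => ?_
      simp [norm_smul, abs_of_pos (ν.pos x), (ν.pos x).ne']
    · ext x
      have : (ν x : ℂ) ≠ 0 := by exact_mod_cast (ν.pos x).ne'
      change (ν x : ℂ) • ((ν x : ℂ)⁻¹ • g x) = g x
      rw [smul_smul, mul_inv_cancel₀ this, one_smul]
  exact (hΦ.isUniformInducing.completeSpace_congr hsurj).2 inferInstance

/-- The summand `f(y) α_y[g(y⁻¹x)] ω(y, y⁻¹x)` of the twisted convolution. -/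
def convTerm (S : TwistedCStarSystem G A) (f g : G → A) (x y : G) : A :=
  (S.ω y (y⁻¹ * x) : 𝓜(ℂ, A)).snd (f y * S.α y (g (y⁻¹ * x)))

/-- The twisted convolution `(f ⋄ g)(x) = ∑_y f(y) α_y[g(y⁻¹x)] ω(y, y⁻¹x)`. -/
def conv (S : TwistedCStarSystem G A) (f g : G → A) (x : G) : A :=
  ∑' y, convTerm S f g x y

/-- The twisted involution `f^⋄(x) = ω(x, x⁻¹)^* α_x[f(x⁻¹)]^*`. -/
def invol (S : TwistedCStarSystem G A) (f : G → A) (x : G) : A :=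
  (star (S.ω x x⁻¹ : 𝓜(ℂ, A))).fst (star (S.α x (f x⁻¹)))

theorem norm_convTerm_le (f g : G → A) (x y : G) :
    ‖convTerm S f g x y‖ ≤ ‖f y‖ * ‖g (y⁻¹ * x)‖ := by
  refine (norm_snd_le _ _).trans ((norm_mul_le _ _).trans ?_)
  rw [norm_aut]

theorem summable_prod (f g : TwistedCrossedProduct S ν) :
    Summable fun p : G × G => (ν p.1 * ‖f p.1‖) * (ν (p.1⁻¹ * p.2) * ‖g (p.1⁻¹ * p.2)‖) := by
  have h := Summable.mul_of_nonneg f.summable_weight g.summable_weight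
    (fun x => mul_nonneg (ν.nonneg x) (norm_nonneg _))
    (fun x => mul_nonneg (ν.nonneg x) (norm_nonneg _))
  let e : G × G ≃ G × G :=
    { toFun := fun p => (p.1, p.1⁻¹ * p.2)
      invFun := fun p => (p.1, p.1 * p.2)
      left_inv := fun p => by simp
      right_inv := fun p => by simp }
  exact (e.summable_iff).2 h

theorem weight_norm_convTerm_le (f g : G → A) (x y : G) :
    ν x * ‖convTerm S f g x y‖ ≤ (ν y * ‖f y‖) * (ν (y⁻¹ * x) * ‖g (y⁻¹ * x)‖) := by
  have h1 := norm_convTerm_le (S := S) f g x y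
  have h2 : ν x ≤ ν y * ν (y⁻¹ * x) := by
    have := ν.mul_le' y (y⁻¹ * x)
    rwa [mul_inv_cancel_left] at this
  calc ν x * ‖convTerm S f g x y‖
      ≤ (ν y * ν (y⁻¹ * x)) * (‖f y‖ * ‖g (y⁻¹ * x)‖) :=
        mul_le_mul h2 h1 (norm_nonneg _) (mul_nonneg (ν.nonneg _) (ν.nonneg _))
    _ = _ := by ring

theorem summable_weight_convTerm (f g : TwistedCrossedProduct S ν) :
    Summable fun p : G × G => ν p.2 * ‖convTerm S f g p.2 p.1‖ :=
  Summable.of_nonneg_of_le (fun _ => mul_nonneg (ν.nonneg _) (norm_nonneg _))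
    (fun _ => weight_norm_convTerm_le _ _ _ _) (summable_prod f g)

theorem summable_norm_convTerm (f g : TwistedCrossedProduct S ν) :
    Summable fun p : G × G => ‖convTerm S f g p.2 p.1‖ :=
  Summable.of_nonneg_of_le (fun _ => norm_nonneg _)
    (fun p => le_mul_of_one_le_left (norm_nonneg _) (ν.one_le' p.2)) (summable_weight_convTerm f g)

theorem summable_norm_convTerm_right (f g : TwistedCrossedProduct S ν) (x : G) :
    Summable fun y => ‖convTerm S f g x y‖ :=
  (summable_norm_convTerm f g).prod_symm.prod_factor x

theorem summable_convTerm (f g : TwistedCrossedProduct S ν) (x : G) :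
    Summable fun y => convTerm S f g x y :=
  (summable_norm_convTerm_right f g x).of_norm

theorem weight_norm_conv_le (f g : TwistedCrossedProduct S ν) (x : G) :
    ν x * ‖conv S f g x‖ ≤ ∑' y, ν x * ‖convTerm S f g x y‖ := by
  rw [tsum_mul_left]
  exact mul_le_mul_of_nonneg_left (norm_tsum_le_tsum_norm (summable_norm_convTerm_right f g x))
    (ν.nonneg x)

theorem conv_mem (f g : TwistedCrossedProduct S ν) : conv S f g ∈ weightedL1 A ν :=
  Summable.of_nonneg_of_le (fun x => mul_nonneg (ν.nonneg x) (norm_nonneg _))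
    (weight_norm_conv_le f g) (summable_weight_convTerm f g).prod_symm.prod

theorem weight_norm_invol_le (f : G → A) (x : G) :
    ν x * ‖invol S f x‖ ≤ ν x⁻¹ * ‖f x⁻¹‖ := by
  rw [ν.inv']
  refine mul_le_mul_of_nonneg_left ?_ (ν.nonneg x)
  have h := norm_fst_le (star (S.ω x x⁻¹)) (star (S.α x (f x⁻¹)))
  rwa [norm_star, norm_aut] at h

theorem summable_weight_inv (f : TwistedCrossedProduct S ν) :
    Summable fun x => ν x⁻¹ * ‖f x⁻¹‖ :=
  ((Equiv.inv G).summable_iff (f := fun x => ν x * ‖f x‖)).2 f.summable_weight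

theorem invol_mem (f : TwistedCrossedProduct S ν) : invol S f ∈ weightedL1 A ν :=
  Summable.of_nonneg_of_le (fun x => mul_nonneg (ν.nonneg x) (norm_nonneg _))
    (weight_norm_invol_le f) f.summable_weight_inv

instance instMul : Mul (TwistedCrossedProduct S ν) := ⟨fun f g => ⟨conv S f g, conv_mem f g⟩⟩

instance instStar : Star (TwistedCrossedProduct S ν) := ⟨fun f => ⟨invol S f, invol_mem f⟩⟩

theorem mul_apply (f g : TwistedCrossedProduct S ν) (x : G) :
    (f * g) x = ∑' y, convTerm S f g x y := rfl

theorem star_apply (f : TwistedCrossedProduct S ν) (x : G) :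
    (star f) x = (star (S.ω x x⁻¹ : 𝓜(ℂ, A))).fst (star (S.α x (f x⁻¹))) := rfl

/-- The automorphism `α_x` as a continuous linear map. -/
def autL (φ : A ≃⋆ₐ[ℂ] A) : A →L[ℂ] A :=
  LinearMap.mkContinuous
    { toFun := φ
      map_add' := map_add φ
      map_smul' := fun c a => by simp } 1 (fun a => by simp [norm_aut])

theorem α_one (a : A) : S.α 1 a = a := by
  have h := S.α_comp 1 1 a
  rw [S.ω_one_left] at h
  have h2 := coe_inj (by simpa using h)
  exact (S.α 1).injective h2

theorem star_mul_ω (x y : G) :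
    star (S.ω x y : 𝓜(ℂ, A)) * (S.ω x y : 𝓜(ℂ, A)) = 1 := Unitary.coe_star_mul_self _

theorem ω_mul_star (x y : G) :
    (S.ω x y : 𝓜(ℂ, A)) * star (S.ω x y : 𝓜(ℂ, A)) = 1 := Unitary.coe_mul_star_self _

theorem assoc_term (f g h : G → A) (x z w : G) :
    convTerm S (fun y => convTerm S f g y z) h x (z * w) =
      convTerm S f (fun t => convTerm S g h t w) x z := by
  apply coe_inj
  have hα := S.α_comp z w (h (w⁻¹ * (z⁻¹ * x)))
  have hc := S.cocycle z w (w⁻¹ * (z⁻¹ * x))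
  rw [mul_inv_cancel_left] at hc
  simp only [convTerm, coe_snd_apply, coe_mul, ← extend_coe (S.α z), extend_mul, mul_inv_rev,
    inv_mul_cancel_left, mul_assoc] at hα ⊢
  simp only [extend_coe] at hα ⊢
  rw [← hc, hα]
  simp only [mul_assoc]
  rw [← mul_assoc (star (S.ω z w : 𝓜(ℂ, A))), star_mul_ω, one_mul]

theorem mul_assoc_aux (f g h : TwistedCrossedProduct S ν) : f * g * h = f * (g * h) := by
  refine ext fun x => ?_
  rw [mul_apply, mul_apply]
  have hL : ∀ y, convTerm S (f * g : TwistedCrossedProduct S ν).toFun h x y =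
      ∑' z, convTerm S (fun y => convTerm S f g y z) h x y := fun y => by
    let T : A →L[ℂ] A := (S.ω y (y⁻¹ * x) : 𝓜(ℂ, A)).snd.comp
      ((ContinuousLinearMap.mul ℂ A).flip (S.α y (h (y⁻¹ * x))))
    exact T.map_tsum (summable_convTerm f g y)
  have hR : ∀ z, convTerm S f (g * h : TwistedCrossedProduct S ν).toFun x z =
      ∑' w, convTerm S f (fun t => convTerm S g h t w) x z := fun z => by
    let T : A →L[ℂ] A := (S.ω z (z⁻¹ * x) : 𝓜(ℂ, A)).snd.comp
      ((ContinuousLinearMap.mul ℂ A (f z)).comp (autL (S.α z)))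
    exact T.map_tsum (summable_convTerm g h (z⁻¹ * x))
  simp_rw [hL, hR, ← assoc_term]
  have hb : ∀ p : G × G, ‖(Function.uncurry fun y z =>
      convTerm S (fun y => convTerm S f g y z) h x y) p‖ ≤ ‖convTerm S f g p.1 p.2‖ * ‖h‖ :=
    fun p => (norm_convTerm_le (S := S) (fun y => convTerm S f g y p.2) h x p.1).trans
      (mul_le_mul_of_nonneg_left (h.norm_apply_le _) (norm_nonneg _))
  have hs : Summable (Function.uncurry fun y z =>
      convTerm S (fun y => convTerm S f g y z) h x y) :=
    Summable.of_norm_bounded (((summable_norm_convTerm f g).prod_symm).mul_right ‖h‖) hb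
  refine hs.tsum_comm.symm.trans ?_
  refine tsum_congr fun z => ?_
  exact ((Equiv.mulLeft z).tsum_eq
    (fun y => convTerm S (fun y => convTerm S f g y z) h x y)).symm

theorem star_mul_term (f g : G → A) (x z : G) :
    (star (S.ω x x⁻¹ : 𝓜(ℂ, A))).fst (star (S.α x (convTerm S f g x⁻¹ (x⁻¹ * z)))) =
      convTerm S (invol S g) (invol S f) x z := by
  apply coe_inj
  have e1 : (x⁻¹ * z)⁻¹ * x⁻¹ = z⁻¹ := by group
  have e2 : (z⁻¹ * x)⁻¹ = x⁻¹ * z := by group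
  have hα1 := S.α_comp x (x⁻¹ * z) (g z⁻¹)
  have hα2 := S.α_comp z (z⁻¹ * x) (f (x⁻¹ * z))
  have hc1 := S.cocycle x (x⁻¹ * z) z⁻¹
  have hc2 := S.cocycle z (z⁻¹ * x) (x⁻¹ * z)
  have e3 : x⁻¹ * z * z⁻¹ = x⁻¹ := by group
  have e4 : z⁻¹ * x * (x⁻¹ * z) = 1 := by group
  rw [mul_inv_cancel_left] at hα1 hα2 hc1 hc2
  rw [e3] at hc1
  rw [e4, S.ω_one_right, OneMemClass.coe_one, mul_one] at hc2
  have hc1' : multiplierExtend (S.α x) (S.ω (x⁻¹ * z) z⁻¹) =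
      (S.ω x (x⁻¹ * z) : 𝓜(ℂ, A)) * (S.ω z z⁻¹ : 𝓜(ℂ, A)) *
        star (S.ω x x⁻¹ : 𝓜(ℂ, A)) := by
    rw [hc1, mul_assoc, ω_mul_star, mul_one]
  have cancel : ∀ (u v : G) (m : 𝓜(ℂ, A)),
      star (S.ω u v : 𝓜(ℂ, A)) * ((S.ω u v : 𝓜(ℂ, A)) * m) = m := fun u v m => by
    rw [← mul_assoc, star_mul_ω, one_mul]
  simp only [convTerm, invol, e1, e2]
  simp only [coe_snd_apply, coe_fst_apply, coe_mul, coe_star, ← extend_coe (S.α x),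
    ← extend_coe (S.α z), extend_mul, extend_star]
  simp only [extend_coe]
  rw [hα1, hα2, hc1', ← hc2]
  simp only [star_mul, star_star, mul_assoc, cancel, star_mul_ω, mul_one]

theorem star_star_aux (f : TwistedCrossedProduct S ν) : star (star f) = f := by
  refine ext fun x => coe_inj ?_
  have hα := S.α_comp x x⁻¹ (f x)
  have hc := S.cocycle x x⁻¹ x
  rw [mul_inv_cancel, S.ω_one_left, inv_mul_cancel, S.ω_one_right, OneMemClass.coe_one, mul_one,
    mul_one] at hc
  rw [mul_inv_cancel, α_one] at hα
  simp only [star_apply, inv_inv]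
  simp only [coe_fst_apply, coe_star, ← extend_coe (S.α x), extend_mul, extend_star]
  simp only [extend_coe, ← hc, hα]
  simp only [star_mul, star_star, mul_assoc, star_mul_ω, mul_one]
  rw [← mul_assoc, star_mul_ω, one_mul]

theorem star_mul_aux (f g : TwistedCrossedProduct S ν) : star (f * g) = star g * star f := by
  refine ext fun x => ?_
  rw [mul_apply, star_apply, mul_apply]
  let T : A →L[ℝ] A := ((star (S.ω x x⁻¹ : 𝓜(ℂ, A))).fst.restrictScalars ℝ).comp
    ((starL' ℝ (A := A) : A →L[ℝ] A).comp ((autL (S.α x)).restrictScalars ℝ))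
  have h1 : (star (S.ω x x⁻¹ : 𝓜(ℂ, A))).fst (star (S.α x (∑' y, convTerm S f g x⁻¹ y))) =
      ∑' y, (star (S.ω x x⁻¹ : 𝓜(ℂ, A))).fst (star (S.α x (convTerm S f g x⁻¹ y))) :=
    T.map_tsum (summable_convTerm f g x⁻¹)
  rw [h1, ← (Equiv.mulLeft x⁻¹).tsum_eq]
  exact tsum_congr fun z => star_mul_term f g x z

instance instNonUnitalNormedRing : NonUnitalNormedRing (TwistedCrossedProduct S ν) :=
  { instNormedAddCommGroup, instMul with
    left_distrib := fun f g h => ext fun x => by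
      rw [add_apply, mul_apply, mul_apply, mul_apply,
        ← (summable_convTerm f g x).tsum_add (summable_convTerm f h x)]
      exact tsum_congr fun y => by simp [convTerm, add_apply, mul_add]
    right_distrib := fun f g h => ext fun x => by
      rw [add_apply, mul_apply, mul_apply, mul_apply,
        ← (summable_convTerm f h x).tsum_add (summable_convTerm g h x)]
      exact tsum_congr fun y => by simp [convTerm, add_apply, add_mul]
    zero_mul := fun f => ext fun x => by simp [mul_apply, convTerm, zero_apply]
    mul_zero := fun f => ext fun x => by simp [mul_apply, convTerm, zero_apply]
    mul_assoc := mul_assoc_aux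
    norm_mul_le := fun f g => by
      have h1 : ‖f * g‖ ≤ ∑' x, ∑' y, ν x * ‖convTerm S f g x y‖ :=
        (f * g).summable_weight.tsum_le_tsum (weight_norm_conv_le f g)
          (summable_weight_convTerm f g).prod_symm.prod
      have h2 : ∑' x, ∑' y, ν x * ‖convTerm S f g x y‖ =
          ∑' p : G × G, ν p.2 * ‖convTerm S f g p.2 p.1‖ := by
        rw [← (Equiv.prodComm G G).tsum_eq]
        exact ((summable_weight_convTerm f g).prod_symm.tsum_prod).symm
      have h3 : ∑' p : G × G, ν p.2 * ‖convTerm S f g p.2 p.1‖ ≤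
          ∑' p : G × G, (ν p.1 * ‖f p.1‖) * (ν (p.1⁻¹ * p.2) * ‖g (p.1⁻¹ * p.2)‖) :=
        (summable_weight_convTerm f g).tsum_le_tsum (fun p => weight_norm_convTerm_le _ _ _ _)
          (summable_prod f g)
      have h4 : ∑' p : G × G, (ν p.1 * ‖f p.1‖) * (ν (p.1⁻¹ * p.2) * ‖g (p.1⁻¹ * p.2)‖) =
          ‖f‖ * ‖g‖ := by
        rw [(summable_prod f g).tsum_prod, norm_def f, ← tsum_mul_right]
        refine tsum_congr fun y => ?_
        dsimp only
        rw [tsum_mul_left, norm_def g]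
        congr 1
        exact (Equiv.mulLeft y⁻¹).tsum_eq (fun t => ν t * ‖g t‖)
      exact h1.trans (h2.le.trans (h3.trans h4.le)) }

instance instStarRing : StarRing (TwistedCrossedProduct S ν) where
  star_involutive := star_star_aux
  star_mul := star_mul_aux
  star_add := fun f g => ext fun x => by simp [star_apply, add_apply]

instance instNormedStarGroup : NormedStarGroup (TwistedCrossedProduct S ν) where
  norm_star_le := fun f => by
    refine ((star f).summable_weight.tsum_le_tsum (weight_norm_invol_le f)
      f.summable_weight_inv).trans (le_of_eq ?_)
    exact (Equiv.inv G).tsum_eq (fun x => ν x * ‖f x‖)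

instance instStarModule : StarModule ℂ (TwistedCrossedProduct S ν) where
  star_smul := fun c f => ext fun x => by simp [star_apply, smul_apply]

instance instIsScalarTower :
    IsScalarTower ℂ (TwistedCrossedProduct S ν) (TwistedCrossedProduct S ν) where
  smul_assoc := fun c f g => ext fun x => by
    rw [smul_eq_mul, smul_eq_mul, smul_apply, mul_apply, mul_apply, ← tsum_const_smul'']
    exact tsum_congr fun y => by
      simp only [convTerm, smul_apply, smul_mul_assoc]
      exact map_smul _ _ _

instance instSMulCommClass :
    SMulCommClass ℂ (TwistedCrossedProduct S ν) (TwistedCrossedProduct S ν) where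
  smul_comm := fun c f g => ext fun x => by
    rw [smul_eq_mul, smul_eq_mul, smul_apply, mul_apply, mul_apply, ← tsum_const_smul'']
    exact tsum_congr fun y => by
      simp only [convTerm, smul_apply, map_smul, mul_smul_comm]

end TwistedCrossedProduct

end

/-! ### Symmetry -/

/-- A (possibly non-unital) Banach `*`-algebra `B` is symmetric if the spectrum of `b* b` is
contained in `[0, ∞)` for every `b`. The spectrum is that computed in the unitization. -/
def IsSymmetricBanachStarAlgebra (B : Type*) [NonUnitalNormedRing B] [StarRing B]
    [NormedStarGroup B] [NormedSpace ℂ B] [IsScalarTower ℂ B B] [SMulCommClass ℂ B B]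
    [StarModule ℂ B] [CompleteSpace B] : Prop :=
  ∀ b : B, ∀ z ∈ quasispectrum ℂ (star b * b), 0 ≤ z.re ∧ z.im = 0

universe u v

/-- The discrete group `G` is rigidly symmetric if `ℓ¹(G; A) ≅ ℓ¹(G) ⊗̂ A`, with the convolution
product and the standard involution, is symmetric for every C*-algebra `A`. -/
def IsRigidlySymmetric (G : Type u) [Group G] : Prop :=
  ∀ (A : Type v) [NonUnitalCStarAlgebra A],
    IsSymmetricBanachStarAlgebra
      (TwistedCrossedProduct (TwistedCStarSystem.trivial G A) (SymmWeight.trivial G))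

/-! Write ‖k‖₁ for the unweighted norm ∑ ‖k x‖. The theorem follows from three facts.

Removal of the twist. The regular representation ξ ↦ (s ↦ π(α_s(a) ω(s, x)) ξ(sx)), taken over all
GNS representations π, gives isometries R_x from the coefficient algebra into one C*-algebra C. By
the cocycle identity they multiply like the elements a δ_x, so f ↦ (x ↦ R_x (f x)) is a
*-homomorphism into the untwisted algebra ℓ¹(G; C), of norm exactly ‖f‖₁. Rigid symmetry makes the
target symmetric (`exists_isometricFamily`, `IsometricFamily.norm_hom`).

Spectral control. Every spectral value of k in the weighted algebra is bounded by ‖k‖₁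
(`norm_le_tsum_norm_of_mem_quasispectrum`). Applying this to h (h - c)ⁿ with h = b* b shows that a
nonzero z in the spectrum of h lies in every disc containing the segment [0, R] around the spectrum
of the image of h. Hence z ≥ 0 (`IsSymmetricBanachStarAlgebra.of_hom`).

Word bounds. Spectral control needs an estimate of log ν(x₁⋯xₙ) in which letters from a prescribed
finite set E are free, other letters cost log ν(x) + C with C independent of E, and the total error
is o(n). Growth of ν alone gives no uniform C; the comparison on spheres does. Put a = log ν, which
up to a constant is a function `prof` of word length. If `prof` is bounded along a sequence, a
Busemann function places finite subsets of G on the line, with a(y⁻¹y') close to `prof` of the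
distance. The same holds if `prof` tends to infinity and large balls stay near geodesics. In the
remaining case G contains triangles with side lengths close to any three lengths obeying the
triangle inequality, so `prof` is itself subadditive on such triples. In each case a word is
followed by an integer displacement or length, and free letters change it by O(n) in total, which
subexponential growth makes negligible (`ShellLength.hasWordBound`). -/

/-! ### Subadditive functions that are almost constant on the spheres of a word length -/

/-- A subadditive symmetric function `a` on `G` that agrees, up to a constant, with a function
`prof` of a (not necessarily symmetric) word length `len`. -/
structure ShellLength (G : Type*) [Group G] where
  a : G → ℝ
  len : G → ℕ
  prof : ℕ → ℝ
  bnd : ℕ → ℝ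
  c : ℝ
  a_mul : ∀ x y, a (x * y) ≤ a x + a y
  a_inv : ∀ x, a x⁻¹ = a x
  len_one : len 1 = 0
  eq_one_of_len : ∀ x, len x = 0 → x = 1
  len_mul : ∀ x y, len (x * y) ≤ len x + len y
  exists_split : ∀ x m n, len x = m + n → ∃ y z, x = y * z ∧ len y = m ∧ len z = n
  exists_len : ∀ n, ∃ x, len x = n
  near : ∀ x, |a x - prof (len x)| ≤ c
  prof_nonneg : ∀ n, 0 ≤ prof n
  bnd_mono : Monotone bnd
  prof_le : ∀ n, prof n ≤ bnd n

namespace ShellLength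

variable {G : Type*} [Group G] (D : ShellLength G)

/-- Subadditivity of `a` along words in which the letters from a finite set cost nothing, up to an
error depending only on the number of letters. -/
def HasWordBound : Prop :=
  ∃ C : ℝ, 0 ≤ C ∧ ∀ E : Finset G, ∃ K : ℕ, ∀ l : List G,
    D.a l.prod ≤ (l.map fun x => by classical exact if x ∈ E then 0 else D.a x + C).sum +
      D.bnd (K * l.length) + C

/-- On finite sets `a (y⁻¹ y')` is, up to a constant, a function of the distance of images in the
integers. -/
def EmbedsInLine : Prop :=
  ∃ (C : ℝ) (κ : G → ℕ), ∀ S : Finset G, ∃ i : G → ℤ, ∀ y ∈ S, ∀ y' ∈ S,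
    |D.prof (i y' - i y).natAbs - D.a (y⁻¹ * y')| ≤ C ∧ (i y' - i y).natAbs ≤ κ (y⁻¹ * y')

/-- The triangle inequality for `prof` on all triples of lengths that form a triangle. -/
def HasTriangles : Prop :=
  ∃ H : ℝ, ∀ p q r : ℕ, r ≤ p + q → p ≤ q + r → q ≤ p + r →
    D.prof r ≤ D.prof p + D.prof q + H

/-- `γ` is a geodesic path on `{0, …, n}`. -/
def IsGeodesic (n : ℕ) (γ : ℕ → G) : Prop :=
  ∀ i j, i ≤ j → j ≤ n → D.len ((γ i)⁻¹ * γ j) = j - i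

/-- Arbitrarily large balls lie in a uniform neighbourhood of a geodesic. -/
def IsLinelike : Prop :=
  ∃ W : ℕ, ∀ s : ℕ, ∃ (n k : ℕ) (γ : ℕ → G), k ≤ n ∧ D.IsGeodesic n γ ∧
    ∀ g, D.len g ≤ s → ∃ i ≤ n, D.len ((γ i)⁻¹ * γ k * g) ≤ W

/-! ### Coarse subadditivity of the profile. -/

theorem c_nonneg : 0 ≤ D.c := (abs_nonneg _).trans (D.near 1)

theorem a_le (x : G) : D.a x ≤ D.prof (D.len x) + D.c := by
  have := (abs_le.1 (D.near x)).2
  linarith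

theorem le_a (x : G) : D.prof (D.len x) ≤ D.a x + D.c := by
  have := (abs_le.1 (D.near x)).1
  linarith

theorem le_a_inv (x : G) : D.prof (D.len x⁻¹) ≤ D.a x + D.c := by
  have := D.le_a x⁻¹
  rwa [D.a_inv] at this

theorem a_le_inv (x : G) : D.a x ≤ D.prof (D.len x⁻¹) + D.c := by
  have := D.a_le x⁻¹
  rwa [D.a_inv] at this

theorem prof_add (m n : ℕ) : D.prof (m + n) ≤ D.prof m + D.prof n + 3 * D.c := by
  obtain ⟨x, hx⟩ := D.exists_len (m + n)
  obtain ⟨y, z, rfl, rfl, rfl⟩ := D.exists_split x m n hx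
  have h := D.le_a (y * z)
  rw [hx] at h
  linarith [D.a_mul y z, D.a_le y, D.a_le z]

/-- Remove the last n letters of an element of length m + n by multiplying with their inverse, whose
cost is the same because `a` is symmetric, although `len` need not be. -/
theorem prof_le_add_left (m n : ℕ) : D.prof m ≤ D.prof (m + n) + D.prof n + 3 * D.c := by
  obtain ⟨x, hx⟩ := D.exists_len (m + n)
  obtain ⟨y, z, rfl, rfl, rfl⟩ := D.exists_split x m n hx
  have h := D.a_le (y * z)
  have h1 := D.a_mul (y * z) z⁻¹
  rw [mul_inv_cancel_right, D.a_inv] at h1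
  rw [hx] at h
  linarith [D.a_le z, D.le_a y]

/-- `prof`, extended evenly to the integers, is subadditive up to a constant. -/
theorem prof_natAbs_add (k l : ℤ) :
    D.prof (k + l).natAbs ≤ D.prof k.natAbs + D.prof l.natAbs + 3 * D.c := by
  have h : (k + l).natAbs = k.natAbs + l.natAbs ∨ k.natAbs = (k + l).natAbs + l.natAbs ∨
      l.natAbs = (k + l).natAbs + k.natAbs := by omega
  rcases h with h | h | h
  · rw [h]
    exact D.prof_add _ _
  · have := D.prof_le_add_left (k + l).natAbs l.natAbs
    rwa [← h] at this
  · have := D.prof_le_add_left (k + l).natAbs k.natAbs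
    rw [← h] at this
    linarith

theorem prof_natAbs_sub (k l : ℤ) :
    D.prof (k - l).natAbs ≤ D.prof k.natAbs + D.prof l.natAbs + 3 * D.c := by
  have := D.prof_natAbs_add k (-l)
  rwa [Int.natAbs_neg, ← sub_eq_add_neg] at this

/-- The profile need not be monotone, so nearby lengths are compared through subadditivity on the
integers, and the difference is charged to the monotone majorant `bnd`. -/
theorem prof_le_of_close {m n R : ℕ} (h1 : m ≤ n + R) (h2 : n ≤ m + R) :
    D.prof m ≤ D.prof n + D.bnd R + 3 * D.c := by
  have h := D.prof_natAbs_add n ((m : ℤ) - n)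
  have e : ((n : ℤ) + (m - n)).natAbs = m := by omega
  rw [e, Int.natAbs_natCast] at h
  have h3 : D.prof ((m : ℤ) - n).natAbs ≤ D.bnd R :=
    (D.prof_le _).trans (D.bnd_mono (by omega))
  linarith

/-- The partial products of a word become a walk on the integers, where displacements commute, so
the steps coming from E can be collected into a single one, even though they are scattered through
the word. -/
theorem EmbedsInLine.hasWordBound (h : D.EmbedsInLine) : D.HasWordBound := by
  classical
  obtain ⟨C, κ, h⟩ := h
  have hC : 0 ≤ C := by
    obtain ⟨i, hi⟩ := h {1}
    exact (abs_nonneg _).trans (hi 1 (by simp) 1 (by simp)).1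
  have hc := D.c_nonneg
  refine ⟨C + D.prof 0 + 3 * D.c, by linarith [D.prof_nonneg 0], fun E => ?_⟩
  let K := E.sup κ
  refine ⟨K, fun l => ?_⟩
  obtain ⟨i, hi⟩ := h (l.inits.map List.prod).toFinset
  -- Here s is the total displacement from letters of E, each moving at most K, and t that from the
  -- other letters. Only t pays for its steps, one application of subadditivity per letter.
  have key : ∀ (l' : List G) (y : G),
      (∀ p, p <+: l' → y * p.prod ∈ (l.inits.map List.prod).toFinset) →
      ∃ s t : ℤ, i (y * l'.prod) - i y = s + t ∧ s.natAbs ≤ K * l'.length ∧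
        D.prof t.natAbs ≤
          (l'.map fun x => if x ∈ E then 0 else D.a x + (C + D.prof 0 + 3 * D.c)).sum +
            D.prof 0 := by
    intro l'
    induction l' with
    | nil =>
      intro y hy
      exact ⟨0, 0, by simp⟩
    | cons x l' ih =>
      intro y hy
      have hy0 := hy [] (List.nil_prefix)
      have hy1 := hy [x] (by simp)
      simp only [List.prod_nil, mul_one, List.prod_singleton] at hy0 hy1
      obtain ⟨s, t, h1, h2, h3⟩ := ih (y * x) (fun p hp => by
        have := hy (x :: p) (by simpa using hp)
        simpa [mul_assoc] using this)
      have hx := hi y hy0 (y * x) hy1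
      rw [inv_mul_cancel_left] at hx
      rw [List.prod_cons, ← mul_assoc]
      by_cases hxE : x ∈ E
      · refine ⟨s + (i (y * x) - i y), t, by omega, ?_, by simpa [hxE] using h3⟩
        have : κ x ≤ K := Finset.le_sup (f := κ) hxE
        rw [List.length_cons, mul_add, mul_one]
        have := hx.2
        omega
      · refine ⟨s, t + (i (y * x) - i y), by omega, ?_, ?_⟩
        · rw [List.length_cons, mul_add]
          omega
        · have h4 := D.prof_natAbs_add t (i (y * x) - i y)
          have h5 := (abs_le.1 hx.1).2
          have h6 := D.prof_nonneg 0
          simp only [List.map_cons, List.sum_cons, if_neg hxE]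
          linarith
  have hmem : ∀ p, p <+: l → (1 : G) * p.prod ∈ (l.inits.map List.prod).toFinset := by
    intro p hp
    simp only [one_mul, List.mem_toFinset, List.mem_map, List.mem_inits]
    exact ⟨p, hp, rfl⟩
  obtain ⟨s, t, h1, h2, h3⟩ := key l 1 hmem
  have h0 := hmem [] List.nil_prefix
  have h0' := hmem l (List.prefix_refl l)
  simp only [List.prod_nil, mul_one] at h0
  have hx := (abs_le.1 (hi 1 h0 _ h0').1).1
  rw [h1, one_mul, inv_one, one_mul] at hx
  have h4 := D.prof_natAbs_add s t
  have h5 := (D.prof_le s.natAbs).trans (D.bnd_mono h2)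
  linarith

/-! ### Geodesics, and profiles bounded along a subsequence. -/

theorem exists_path (x : G) : ∃ γ : ℕ → G, γ 0 = 1 ∧ γ (D.len x) = x ∧
    (∀ i ≤ D.len x, D.len (γ i) = i) ∧ ∀ i < D.len x, D.len ((γ i)⁻¹ * γ (i + 1)) = 1 := by
  induction hn : D.len x generalizing x with
  | zero =>
    exact ⟨fun _ => 1, rfl, (D.eq_one_of_len x hn).symm,
      fun i hi => by rw [D.len_one, Nat.le_zero.1 hi], by simp⟩
  | succ n ih =>
    obtain ⟨y, z, rfl, hy, hz⟩ := D.exists_split x n 1 hn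
    obtain ⟨γ, h0, h1, h2, h3⟩ := ih y hy
    refine ⟨fun i => if i ≤ n then γ i else y * z, by simpa, by simp, fun i hi => ?_,
      fun i hi => ?_⟩
    · by_cases h : i ≤ n
      · simp [h, h2 i h]
      · have : i = n + 1 := by omega
        subst this
        simp [hn]
    · rcases Nat.lt_succ_iff_lt_or_eq.1 hi with h | rfl
      · simp [h.le, Nat.succ_le_of_lt h, h3 i h]
      · simp [h1, hz]

theorem exists_isGeodesic (n : ℕ) : ∃ γ : ℕ → G, D.IsGeodesic n γ := by
  obtain ⟨x, rfl⟩ := D.exists_len n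
  obtain ⟨γ, -, -, h2, h3⟩ := D.exists_path x
  refine ⟨γ, fun i j hij hj => le_antisymm ?_ ?_⟩
  · obtain ⟨d, rfl⟩ := Nat.exists_eq_add_of_le hij
    rw [Nat.add_sub_cancel_left]
    clear hij
    induction d with
    | zero => simp [D.len_one]
    | succ d ih =>
      have e : (γ i)⁻¹ * γ (i + (d + 1)) =
          (γ i)⁻¹ * γ (i + d) * ((γ (i + d))⁻¹ * γ (i + d + 1)) := by
        rw [mul_assoc, mul_inv_cancel_left, add_assoc]
      rw [e]
      have := D.len_mul ((γ i)⁻¹ * γ (i + d)) ((γ (i + d))⁻¹ * γ (i + d + 1))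
      have h4 := h3 (i + d) (by omega)
      have h5 := ih (by omega)
      omega
  · have := D.len_mul (γ i) ((γ i)⁻¹ * γ j)
    rw [mul_inv_cancel_left, h2 j hj, h2 i (hij.trans hj)] at this
    omega

/-- A bounded monotone function on a long interval is constant on a window of prescribed width
around some point of a given infinite set. -/
theorem exists_window {P : ℕ → Prop} (hP : ∀ N, ∃ L, N ≤ L ∧ P L) (R M : ℕ) :
    ∃ N, ∀ f : ℕ → ℕ, MonotoneOn f (Set.Iic N) → f N ≤ M →
      ∃ L, P L ∧ R ≤ L ∧ L + R ≤ N ∧ f (L - R) = f (L + R) := by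
  induction M with
  | zero =>
    obtain ⟨L, hL, hPL⟩ := hP R
    refine ⟨L + R, fun f hf h0 => ⟨L, hPL, hL, le_rfl, ?_⟩⟩
    have := hf (a := L - R) (b := L + R) (by simp; omega) (by simp) (by omega)
    omega
  | succ M ih =>
    obtain ⟨N, hN⟩ := ih
    obtain ⟨L, hL, hPL⟩ := hP (N + R)
    refine ⟨L + R, fun f hf h0 => ?_⟩
    by_cases h : f (L - R) = f (L + R)
    · exact ⟨L, hPL, by omega, le_rfl, h⟩
    · have h1 := hf (a := L - R) (b := L + R) (by simp; omega) (by simp) (by omega)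
      have h2 := hf (a := N) (b := L - R) (by simp; omega) (by simp; omega) (by omega)
      obtain ⟨L', h3, h4, h5, h6⟩ := hN f (hf.mono (Set.Iic_subset_Iic.2 (by omega))) (by omega)
      exact ⟨L', h3, h4, by omega, h6⟩

/-- If `prof` is bounded along a subsequence, Busemann functions embed finite sets in the line. -/
theorem embedsInLine_of_frequently {b : ℝ} (hb : ∀ N, ∃ L, N ≤ L ∧ D.prof L ≤ b) :
    D.EmbedsInLine := by
  have hc := D.c_nonneg
  refine ⟨2 * b + 5 * D.c, fun g => max (D.len g) (D.len g⁻¹), fun S => ?_⟩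
  -- R bounds both the total increase of the Busemann defects of S and the shifts needed below.
  set R := ∑ y ∈ S, (D.len y + D.len y⁻¹) with hR
  obtain ⟨N, hN⟩ := exists_window hb R R
  obtain ⟨γ, hγ⟩ := D.exists_isGeodesic N
  -- Γ i * y represents y as seen from the point i steps before the end of the geodesic. As i grows,
  -- the defect i + |y| - |Γ i * y| increases to a bounded limit, as for Busemann functions.
  let Γ : ℕ → G := fun i => (γ (N - i))⁻¹ * γ N
  have hΓ : ∀ i ≤ N, D.len (Γ i) = i := fun i hi => by
    have : D.len (Γ i) = N - (N - i) := hγ (N - i) N (by omega) le_rfl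
    omega
  have hΓs : ∀ i < N, ∀ y, D.len (Γ (i + 1) * y) ≤ 1 + D.len (Γ i * y) := fun i hi y => by
    have e : Γ (i + 1) * y = ((γ (N - (i + 1)))⁻¹ * γ (N - i)) * (Γ i * y) := by
      simp only [Γ]
      group
    rw [e]
    refine (D.len_mul _ _).trans ?_
    rw [hγ _ _ (by omega) (by omega)]
    omega
  have hup : ∀ i ≤ N, ∀ y, D.len (Γ i * y) ≤ i + D.len y := fun i hi y =>
    (D.len_mul _ _).trans_eq (by rw [hΓ i hi])
  have hlo : ∀ i ≤ N, ∀ y, i ≤ D.len (Γ i * y) + D.len y⁻¹ := fun i hi y => by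
    have := D.len_mul (Γ i * y) y⁻¹
    rwa [mul_inv_cancel_right, hΓ i hi] at this
  let δ : G → ℕ → ℕ := fun y i => i + D.len y - D.len (Γ i * y)
  have hδ : ∀ y, MonotoneOn (δ y) (Set.Iic N) := fun y i hi j hj hij => by
    simp only [Set.mem_Iic] at hi hj
    induction j, hij using Nat.le_induction with
    | base => exact le_rfl
    | succ j hij ih =>
      refine (ih (by omega)).trans ?_
      have := hΓs j (by omega) y
      simp only [δ]
      omega
  obtain ⟨L, hL, hRL, hLN, hf⟩ := hN (fun i => ∑ y ∈ S, δ y i)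
    (fun i hi j hj hij => Finset.sum_le_sum fun y _ => hδ y hi hj hij)
    (Finset.sum_le_sum fun y _ => by
      have := hlo N le_rfl y
      simp only [δ]
      omega)
  have hf' : ∀ y ∈ S, δ y (L - R) = δ y (L + R) :=
    (Finset.sum_eq_sum_iff_of_le fun y _ => hδ y (by simp; omega) (by simp; omega) (by omega)).1 hf
  have hconst : ∀ y ∈ S, ∀ i, L - R ≤ i → i ≤ L + R →
      (D.len (Γ i * y) : ℤ) = i + (D.len (Γ L * y) - L) := fun y hy i h1 h2 => by
    have e1 := hδ y (a := L - R) (b := i) (by simp; omega) (by simp; omega) h1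
    have e2 := hδ y (a := i) (b := L + R) (by simp; omega) (by simp; omega) h2
    have e3 := hδ y (a := L - R) (b := L) (by simp; omega) (by simp; omega) (by omega)
    have e4 := hδ y (a := L) (b := L + R) (by simp; omega) (by simp; omega) (by omega)
    have e5 := hf' y hy
    have e6 := hup i (by omega) y
    have e7 := hup L (by omega) y
    simp only [δ] at e1 e2 e3 e4 e5
    omega
  -- On the window |Γ i * y| = i + β(y) for every y in S. The embedding is β.
  refine ⟨fun y => (D.len (Γ L * y) : ℤ) - L, fun y hy y' hy' => ?_⟩
  have hyR : D.len y + D.len y⁻¹ ≤ R :=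
    Finset.single_le_sum (f := fun y => D.len y + D.len y⁻¹) (fun _ _ => Nat.zero_le _) hy
  have u1 := hup L (by omega) y
  have u2 := hlo L (by omega) y
  -- Shifting the base point by β(y) puts y at length exactly L, where `prof` is at most b. Then `a`
  -- of Γ i * y is bounded, so replacing y⁻¹ * y' by Γ i * y', of length L + d, costs a constant,
  -- and so does replacing `prof` at L + d by `prof` at |d|.
  obtain ⟨i, hi⟩ : ∃ i : ℕ, (i : ℤ) = L - ((D.len (Γ L * y) : ℤ) - L) :=
    ⟨(L - ((D.len (Γ L * y) : ℤ) - L)).toNat, by omega⟩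
  have h1 := hconst y hy i (by omega) (by omega)
  have h2 := hconst y' hy' i (by omega) (by omega)
  set d : ℤ := (D.len (Γ L * y') - L) - (D.len (Γ L * y) - L) with hd
  have h1' : D.len (Γ i * y) = L := by omega
  have h2' : (D.len (Γ i * y') : ℤ) = L + d := by omega
  have e : y⁻¹ * y' = (Γ i * y)⁻¹ * (Γ i * y') := by group
  have e' : Γ i * y' = (Γ i * y) * (y⁻¹ * y') := by group
  have n1 := D.near (Γ i * y)
  have n2 := D.near (Γ i * y')
  rw [h1'] at n1
  rw [abs_le] at n1 n2
  have m1 := D.a_mul (Γ i * y)⁻¹ (Γ i * y')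
  rw [← e, D.a_inv] at m1
  have m2 := D.a_mul (Γ i * y) (y⁻¹ * y')
  rw [← e'] at m2
  have p1 := D.prof_natAbs_sub (L + d) L
  have p2 := D.prof_natAbs_add L d
  rw [← h2', Int.natAbs_natCast, Int.natAbs_natCast] at p1 p2
  rw [h2', add_sub_cancel_left] at p1
  constructor
  · rw [abs_le]
    constructor <;> linarith
  · have l1 := D.len_mul (Γ L * y) (y⁻¹ * y')
    have l2 := D.len_mul (Γ L * y') (y⁻¹ * y')⁻¹
    have e1 : Γ L * y * (y⁻¹ * y') = Γ L * y' := by group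
    have e2 : Γ L * y' * (y⁻¹ * y')⁻¹ = Γ L * y := by group
    rw [e1] at l1
    rw [e2] at l2
    have := le_max_left (D.len (y⁻¹ * y')) (D.len (y⁻¹ * y')⁻¹)
    have := le_max_right (D.len (y⁻¹ * y')) (D.len (y⁻¹ * y')⁻¹)
    change d.natAbs ≤ max (D.len (y⁻¹ * y')) (D.len (y⁻¹ * y')⁻¹)
    omega

/-! ### Profiles tending to infinity: linelike groups and fat triangles. -/

/-- The inverse of an element of length `≤ n` has bounded length when `prof` tends to infinity. -/
theorem exists_len_inv_le (h : Tendsto D.prof atTop atTop) (n : ℕ) :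
    ∃ m, ∀ x, D.len x ≤ n → D.len x⁻¹ ≤ m := by
  obtain ⟨m, hm⟩ := (tendsto_atTop.1 h (D.bnd n + 2 * D.c + 1)).exists_forall_of_atTop
  refine ⟨m, fun x hx => ?_⟩
  by_contra! hlt
  have h1 := hm _ hlt.le
  have h2 := D.le_a_inv x
  have h3 := D.a_le x
  have h4 := (D.prof_le (D.len x)).trans (D.bnd_mono hx)
  linarith

/-- Send y to the index of a point of the geodesic within W of γ k * y. Both endpoints move by
bounded amounts, so y⁻¹ * y' has nearly the same `a` as a geodesic segment whose length is the
difference of the indices. -/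
theorem IsLinelike.embedsInLine (hL : D.IsLinelike) (h : Tendsto D.prof atTop atTop) :
    D.EmbedsInLine := by
  obtain ⟨W, hW⟩ := hL
  obtain ⟨W', hW'⟩ := D.exists_len_inv_le h W
  refine ⟨2 * D.bnd W + 3 * D.c, fun g => W + W' + D.len g + D.len g⁻¹, fun S => ?_⟩
  obtain ⟨n, k, γ, hk, hγ, H⟩ := hW (S.sup D.len)
  have H' : ∀ y, ∃ i, y ∈ S → i ≤ n ∧ D.len ((γ i)⁻¹ * γ k * y) ≤ W := fun y => by
    by_cases hy : y ∈ S
    · obtain ⟨i, h1, h2⟩ := H y (Finset.le_sup (f := D.len) hy)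
      exact ⟨i, fun _ => ⟨h1, h2⟩⟩
    · exact ⟨0, fun hy' => absurd hy' hy⟩
  choose i hi using H'
  refine ⟨fun y => i y, fun y hy y' hy' => ?_⟩
  obtain ⟨hiy, hρ⟩ := hi y hy
  obtain ⟨hiy', hρ'⟩ := hi y' hy'
  set ρ := (γ (i y))⁻¹ * γ k * y with hρd
  set ρ' := (γ (i y'))⁻¹ * γ k * y' with hρd'
  set τ := (γ (i y))⁻¹ * γ (i y') with hτ
  have hτa : |D.a τ - D.prof ((i y' : ℤ) - i y).natAbs| ≤ D.c := by
    rcases le_total (i y) (i y') with hle | hle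
    · have h1 := hγ _ _ hle hiy'
      have h2 := D.near τ
      rw [h1] at h2
      convert h2 using 4
      omega
    · have h1 := hγ _ _ hle hiy
      have h2 := D.near ((γ (i y'))⁻¹ * γ (i y))
      have h3 : (γ (i y'))⁻¹ * γ (i y) = τ⁻¹ := by rw [hτ]; group
      rw [h1, h3, D.a_inv] at h2
      convert h2 using 4
      omega
  have e1 : y⁻¹ * y' = ρ⁻¹ * τ * ρ' := by rw [hρd, hρd', hτ]; group
  have e2 : τ = ρ * (y⁻¹ * y') * ρ'⁻¹ := by rw [hρd, hρd', hτ]; group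
  have hρa := D.a_le ρ
  have hρa' := D.a_le ρ'
  have b1 := (D.prof_le _).trans (D.bnd_mono hρ)
  have b2 := (D.prof_le _).trans (D.bnd_mono hρ')
  constructor
  · have m1 := D.a_mul (ρ⁻¹ * τ) ρ'
    have m2 := D.a_mul ρ⁻¹ τ
    have m3 := D.a_mul (ρ * (y⁻¹ * y')) ρ'⁻¹
    have m4 := D.a_mul ρ (y⁻¹ * y')
    rw [← e1] at m1
    rw [← e2, D.a_inv] at m3
    rw [D.a_inv] at m2
    rw [abs_le] at hτa ⊢
    constructor <;> linarith
  · rcases le_total (i y) (i y') with hle | hle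
    · have h1 : D.len τ = i y' - i y := hγ _ _ hle hiy'
      have m3 := D.len_mul (ρ * (y⁻¹ * y')) ρ'⁻¹
      have m4 := D.len_mul ρ (y⁻¹ * y')
      have m5 := hW' _ hρ'
      rw [← e2] at m3
      simp only
      omega
    · have h1 := hγ _ _ hle hiy
      have h3 : (γ (i y'))⁻¹ * γ (i y) = ρ' * (y⁻¹ * y')⁻¹ * ρ⁻¹ := by
        rw [hρd, hρd']; group
      have m3 := D.len_mul (ρ' * (y⁻¹ * y')⁻¹) ρ⁻¹
      have m4 := D.len_mul ρ' (y⁻¹ * y')⁻¹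
      have m5 := hW' _ hρ
      rw [← h3] at m3
      simp only
      omega

/-- Three lengths are nearly realized by the sides of a triangle in `G`. -/
theorem exists_triangle_of_not_isLinelike (hL : ¬ D.IsLinelike) {d : ℕ}
    (hd : ∀ x, D.len x ≤ 1 → D.len x⁻¹ ≤ d) {q P Q : ℕ} (hq : 0 < q) (hqP : q ≤ P) (hPQ : P ≤ Q)
    (hQ : Q < q + P) :
    ∃ x y, D.len (x * y) = Q ∧ D.len x ≤ q + 2 * (d + 1) ∧ q ≤ D.len x + 2 * (d + 1) ∧
      D.len y ≤ P + 2 * (d + 1) ∧ P ≤ D.len y + 2 * (d + 1) := by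
  unfold IsLinelike at hL
  push Not at hL
  -- For any geodesic and base point γ k, some γ k * g with |g| ≤ s is farther than q from the whole
  -- geodesic. A segment from γ i to γ (i + Q) slides along the geodesic while its apex moves from γ
  -- k to γ k * g. With k and I this large, the apex is at distance at least q from the start of the
  -- first segment, and at least P from the end of the last.
  obtain ⟨s, hs⟩ := hL q
  set k := Q + q + d * s + 1 with hk
  set I := k + P + s with hI
  obtain ⟨γ, hγ⟩ := D.exists_isGeodesic (I + Q)
  obtain ⟨g, hgs, hg⟩ := hs (I + Q) k γ (by omega) hγ
  set m := D.len g with hm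
  obtain ⟨p, hp0, hpm, hpl, hp⟩ := D.exists_path g
  rw [← hm] at hpm hpl hp
  let f : ℕ → ℕ → ℕ := fun i t => D.len ((γ i)⁻¹ * (γ k * p t))
  let e : ℕ → ℕ → ℕ := fun i t => D.len ((γ k * p t)⁻¹ * γ (i + Q))
  by_contra! hno
  have hno : ∀ i t, i ≤ I → ¬ (f i t ≤ q + 2 * (d + 1) ∧ q ≤ f i t + 2 * (d + 1) ∧
      e i t ≤ P + 2 * (d + 1) ∧ P ≤ e i t + 2 * (d + 1)) := fun i t hi h => by
    have := hno ((γ i)⁻¹ * (γ k * p t)) ((γ k * p t)⁻¹ * γ (i + Q)) (by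
      rw [mul_assoc, mul_inv_cancel_left, hγ _ _ (by omega) (by omega)]
      omega) h.1 h.2.1 h.2.2.1
    exact absurd h.2.2.2 (not_le.2 this)
  have mul3 : ∀ x y z : G, D.len (x⁻¹ * z) ≤ D.len (x⁻¹ * y) + D.len (y⁻¹ * z) := fun x y z => by
    have := D.len_mul (x⁻¹ * y) (y⁻¹ * z)
    rwa [mul_assoc, mul_inv_cancel_left] at this
  have inv2 : ∀ x y : G, D.len (x⁻¹ * y) ≤ 1 → D.len (y⁻¹ * x) ≤ d := fun x y h => by
    have := hd _ h
    rwa [mul_inv_rev, inv_inv] at this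
  have γ1 : ∀ i, i < I + Q → D.len ((γ i)⁻¹ * γ (i + 1)) ≤ 1 := fun i hi => by
    rw [hγ _ _ (by omega) (by omega)]
    omega
  have p1 : ∀ t, t < m → D.len ((γ k * p t)⁻¹ * (γ k * p (t + 1))) ≤ 1 := fun t ht => by
    have := hp t ht
    rw [mul_inv_rev, mul_assoc, inv_mul_cancel_left, this]
  have fi : ∀ i t, i < I → f (i + 1) t ≤ d + f i t ∧ f i t ≤ 1 + f (i + 1) t := fun i t hi =>
    ⟨(mul3 _ (γ i) _).trans (Nat.add_le_add_right (inv2 _ _ (γ1 i (by omega))) _),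
      (mul3 _ (γ (i + 1)) _).trans (Nat.add_le_add_right (γ1 i (by omega)) _)⟩
  have ft : ∀ i t, t < m → f i (t + 1) ≤ f i t + 1 ∧ f i t ≤ f i (t + 1) + d := fun i t ht =>
    ⟨(mul3 _ (γ k * p t) _).trans (Nat.add_le_add_left (p1 t ht) _),
      (mul3 _ (γ k * p (t + 1)) _).trans (Nat.add_le_add_left (inv2 _ _ (p1 t ht)) _)⟩
  have ei : ∀ i t, i < I → e (i + 1) t ≤ e i t + 1 ∧ e i t ≤ e (i + 1) t + d := fun i t hi => by
    have h1 := γ1 (i + Q) (by omega)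
    have h2 := inv2 _ _ h1
    rw [show i + Q + 1 = i + 1 + Q by ring] at h1 h2
    exact ⟨(mul3 _ (γ (i + Q)) _).trans (Nat.add_le_add_left h1 _),
      (mul3 _ (γ (i + 1 + Q)) _).trans (Nat.add_le_add_left h2 _)⟩
  have et : ∀ i t, t < m → e i (t + 1) ≤ d + e i t ∧ e i t ≤ 1 + e i (t + 1) := fun i t ht =>
    ⟨(mul3 _ (γ k * p t) _).trans (Nat.add_le_add_right (inv2 _ _ (p1 t ht)) _),
      (mul3 _ (γ k * p (t + 1)) _).trans (Nat.add_le_add_right (p1 t ht) _)⟩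
  have pinv : ∀ t ≤ m, D.len (p t)⁻¹ ≤ d * t := fun t ht => by
    induction t with
    | zero => simp [hp0, D.len_one]
    | succ t ih =>
      have h1 := mul3 (p (t + 1)) (p t) 1
      have h2 := inv2 _ _ (hp t (by omega)).le
      have h3 := ih (by omega)
      rw [mul_one, mul_one] at h1
      rw [mul_add, mul_one]
      omega
  -- A mod 2 intersection count: h and v record the horizontal and vertical edges of the (i, t) grid
  -- on which f crosses level q while e is below P.
  let A : ℕ → ℕ → ZMod 2 := fun i t => if f i t < q then 1 else 0
  let B : ℕ → ℕ → ZMod 2 := fun i t => if e i t < P then 1 else 0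
  let h : ℕ → ℕ → ZMod 2 := fun i t => (A i t + A (i + 1) t) * B i t
  let v : ℕ → ℕ → ZMod 2 := fun i t => (A i t + A i (t + 1)) * B i t
  -- One unit move changes f or e by at most d + 1, so two moves reach all corners of a square
  -- within the tolerance. As f near q and e near P never coincide, A or B is constant on the
  -- corners, and the crossings cancel around the square.
  have hsq : ∀ i t, i < I → t < m → h i (t + 1) - h i t = v (i + 1) t - v i t := by
    intro i t hi ht
    have alg : ∀ a b c d b' c' d' e' : ZMod 2,
        (a = b ∧ a = c ∧ a = d) ∨ (b' = c' ∧ b' = d' ∧ b' = e') →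
        (c + d) * d' - (a + b) * b' = (b + d) * c' - (a + c) * b' := by decide
    refine alg _ _ _ _ _ _ _ (B (i + 1) (t + 1)) ?_
    have f1 := fi i t hi
    have f2 := fi i (t + 1) hi
    have f3 := ft i t ht
    have f4 := ft (i + 1) t ht
    have e1 := ei i t hi
    have e2 := ei i (t + 1) hi
    have e3 := et i t ht
    have e4 := et (i + 1) t ht
    by_cases hA : f i t ≤ q + 2 * (d + 1) ∧ q ≤ f i t + 2 * (d + 1)
    · right
      have hB : ¬ (e i t ≤ P + 2 * (d + 1) ∧ P ≤ e i t + 2 * (d + 1)) := fun hB =>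
        hno i t hi.le ⟨hA.1, hA.2, hB⟩
      simp only [B]
      refine ⟨?_, ?_, ?_⟩ <;> refine if_congr ?_ rfl rfl <;> omega
    · left
      simp only [A]
      refine ⟨?_, ?_, ?_⟩ <;> refine if_congr ?_ rfl rfl <;> omega
  have ds : ∀ t ≤ m, d * t ≤ d * s := fun t ht => Nat.mul_le_mul_left _ (ht.trans hgs)
  have hA0 : ∀ t ≤ m, A 0 t = 0 := fun t ht => by
    refine if_neg ?_
    have h1 := mul3 (γ 0) (γ k * p t) (γ k)
    rw [hγ _ _ (by omega) (by omega), mul_inv_rev, mul_assoc, inv_mul_cancel, mul_one] at h1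
    have h2 := pinv t ht
    have h3 := ds t ht
    change ¬ D.len ((γ 0)⁻¹ * (γ k * p t)) < q
    omega
  have hv0 : ∀ t < m, v 0 t = 0 := fun t ht => by
    simp only [v, hA0 t ht.le, hA0 (t + 1) ht]
    simp
  have hvI : ∀ t < m, v I t = 0 := fun t ht => by
    have hB : B I t = 0 := by
      refine if_neg ?_
      have h1 := mul3 (γ k) (γ k * p t) (γ (I + Q))
      rw [hγ _ _ (by omega) (by omega), inv_mul_cancel_left, hpl t ht.le] at h1
      change ¬ D.len ((γ k * p t)⁻¹ * γ (I + Q)) < P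
      omega
    simp only [v, hB, mul_zero]
  have hrow : ∀ t ≤ m, ∑ i ∈ Finset.range I, h i t = ∑ i ∈ Finset.range I, h i 0 := by
    intro t ht
    induction t with
    | zero => rfl
    | succ t ih =>
      rw [← ih (by omega), ← sub_eq_zero, ← Finset.sum_sub_distrib,
        Finset.sum_congr rfl fun i hi => hsq i t (Finset.mem_range.1 hi) ht,
        Finset.sum_range_sub (fun i => v i t), hv0 t ht, hvI t ht, sub_zero]
  -- The final apex is farther than q from the geodesic, so there is no crossing.
  have htop : ∑ i ∈ Finset.range I, h i m = 0 := by
    have hA : ∀ i ≤ I, A i m = 0 := fun i hi => by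
      refine if_neg ?_
      have := hg i (by omega)
      rw [mul_assoc] at this
      change ¬ D.len ((γ i)⁻¹ * (γ k * p m)) < q
      rw [hpm]
      omega
    refine Finset.sum_eq_zero fun i hi => ?_
    have := Finset.mem_range.1 hi
    simp only [h, hA i (by omega), hA (i + 1) (by omega)]
    simp
  -- With the apex on the geodesic, f falls below q exactly once before i = k, at i = k - q, where e
  -- = Q - q < P by strictness of the triangle. From i = k on, e ≥ Q ≥ P, so later crossings do not
  -- count. The parities 1 and 0 contradict each other.
  have hbot : ∑ i ∈ Finset.range I, h i 0 = 1 := by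
    have hf : ∀ i ≤ k, f i 0 = k - i := fun i hi => by
      have := hγ i k hi (by omega)
      simpa [f, hp0] using this
    have he : ∀ i ≤ I, k ≤ i + Q → e i 0 = i + Q - k := fun i hi hki => by
      have := hγ k (i + Q) hki (by omega)
      simpa [e, hp0] using this
    rw [Finset.sum_eq_single (k - q)]
    · have h1 : A (k - q) 0 = 0 := if_neg (by rw [hf _ (by omega)]; omega)
      have h2 : A (k - q + 1) 0 = 1 := if_pos (by rw [hf _ (by omega)]; omega)
      have h3 : B (k - q) 0 = 1 := if_pos (by rw [he _ (by omega) (by omega)]; omega)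
      simp only [h, h1, h2, h3]
      simp
    · intro i hi hne
      have hi := Finset.mem_range.1 hi
      rcases lt_or_gt_of_ne hne with hlt | hgt
      · have h1 : A i 0 = 0 := if_neg (by rw [hf _ (by omega)]; omega)
        have h2 : A (i + 1) 0 = 0 := if_neg (by rw [hf _ (by omega)]; omega)
        simp only [h, h1, h2]
        simp
      · by_cases hik : i < k
        · have h1 : A i 0 = 1 := if_pos (by rw [hf _ (by omega)]; omega)
          have h2 : A (i + 1) 0 = 1 := if_pos (by rw [hf _ (by omega)]; omega)
          have h3 : (1 + 1 : ZMod 2) = 0 := by decide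
          simp only [h, h1, h2, h3, zero_mul]
        · have h3 : B i 0 = 0 := if_neg (by rw [he _ (by omega) (by omega)]; omega)
          simp only [h, h3, mul_zero]
    · intro hmem
      exact absurd (Finset.mem_range.2 (by omega)) hmem
  have := hrow m le_rfl
  rw [htop, hbot] at this
  exact absurd this (by decide)

/-- Subadditivity and symmetry of `a` on an actual triangle x, y, x * y yield all three inequalities
between its sides, and the profile inherits them. Degenerate triples come from splitting a single
element. -/
theorem hasTriangles_of_not_isLinelike (hL : ¬ D.IsLinelike) (h : Tendsto D.prof atTop atTop) :
    D.HasTriangles := by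
  obtain ⟨d, hd⟩ := D.exists_len_inv_le h 1
  have hc := D.c_nonneg
  let R := D.bnd (2 * (d + 1)) + 4 * D.c
  have sorted : ∀ q P Q, q ≤ P → P ≤ Q → Q ≤ q + P → ∃ x y, |D.a x - D.prof q| ≤ R ∧
      |D.a y - D.prof P| ≤ R ∧ |D.a (x * y) - D.prof Q| ≤ R := by
    intro q P Q h1 h2 h3
    have close : ∀ x n, D.len x ≤ n + 2 * (d + 1) → n ≤ D.len x + 2 * (d + 1) →
        |D.a x - D.prof n| ≤ R := fun x n h4 h5 => by
      have h6 := D.prof_le_of_close h4 h5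
      have h7 := D.prof_le_of_close h5 h4
      have h8 := D.a_le x
      have h9 := D.le_a x
      rw [abs_le]
      constructor <;> simp only [R] <;> linarith
    by_cases hQ : Q < q + P
    · obtain ⟨x, y, e1, e2, e3, e4, e5⟩ :=
        D.exists_triangle_of_not_isLinelike hL hd (by omega) h1 h2 hQ
      exact ⟨x, y, close _ _ e2 e3, close _ _ e4 e5, close _ _ (by omega) (by omega)⟩
    · have hQ' : Q = q + P := by omega
      obtain ⟨z, hz⟩ := D.exists_len Q
      obtain ⟨x, y, rfl, e2, e3⟩ := D.exists_split z q P (hz.trans hQ')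
      exact ⟨x, y, close _ _ (by omega) (by omega), close _ _ (by omega) (by omega),
        close _ _ (by omega) (by omega)⟩
  have tri : ∀ q P Q, q ≤ P → P ≤ Q → Q ≤ q + P →
      D.prof Q ≤ D.prof q + D.prof P + 3 * R ∧ D.prof q ≤ D.prof P + D.prof Q + 3 * R ∧
        D.prof P ≤ D.prof q + D.prof Q + 3 * R := by
    intro q P Q h1 h2 h3
    obtain ⟨x, y, e1, e2, e3⟩ := sorted q P Q h1 h2 h3
    rw [abs_le] at e1 e2 e3
    have t1 := D.a_mul x y
    have t2 := D.a_mul (x * y) y⁻¹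
    have t3 := D.a_mul x⁻¹ (x * y)
    rw [mul_inv_cancel_right, D.a_inv] at t2
    rw [inv_mul_cancel_left, D.a_inv] at t3
    refine ⟨?_, ?_, ?_⟩ <;> linarith
  refine ⟨3 * R, fun p q r h1 h2 h3 => ?_⟩
  rcases le_total p q with h4 | h4 <;> rcases le_total q r with h5 | h5 <;>
    rcases le_total p r with h6 | h6
  · linarith [(tri p q r h4 h5 (by omega)).1]
  · linarith [(tri p q r h4 h5 (by omega)).1]
  · linarith [(tri p r q h6 h5 (by omega)).2.2]
  · linarith [(tri r p q h6 h4 (by omega)).2.1]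
  · linarith [(tri q p r h4 h6 (by omega)).1]
  · linarith [(tri q r p h5 h6 (by omega)).2.2]
  · linarith [(tri r q p h5 h4 (by omega)).2.1]
  · linarith [(tri r q p h5 h4 (by omega)).2.1]

/-- Read the word from the right and carry a length t that ignores letters of E. It stays within K
times the number of letters of the true length, where N is the length made symmetric under
inversion. -/
theorem HasTriangles.hasWordBound (h : D.HasTriangles) : D.HasWordBound := by
  classical
  obtain ⟨H, h⟩ := h
  let N : G → ℕ := fun x => max (D.len x) (D.len x⁻¹)
  have N_mul : ∀ x y, N (x * y) ≤ N x + N y := fun x y => by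
    have h1 := D.len_mul x y
    have h2 := D.len_mul y⁻¹ x⁻¹
    rw [← mul_inv_rev] at h2
    simp only [N]
    omega
  have N_inv : ∀ x, N x⁻¹ = N x := fun x => by
    simp only [N, inv_inv, max_comm]
  have N_a : ∀ x, D.a x ≤ D.prof (N x) + D.c ∧ D.prof (N x) ≤ D.a x + D.c := fun x => by
    simp only [N]
    rcases max_choice (D.len x) (D.len x⁻¹) with e | e <;> rw [e]
    · exact ⟨D.a_le x, D.le_a x⟩
    · exact ⟨D.a_le_inv x, D.le_a_inv x⟩
  have hc := D.c_nonneg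
  refine ⟨D.prof 0 + |H| + 4 * D.c + D.prof (N 1), by
    linarith [D.prof_nonneg 0, abs_nonneg H, D.prof_nonneg (N 1)], fun E => ?_⟩
  set C := D.prof 0 + |H| + 4 * D.c + D.prof (N 1) with hC
  refine ⟨E.sup N, fun l => ?_⟩
  have key : ∃ t : ℕ, D.prof t ≤ (l.map fun x => if x ∈ E then 0 else D.a x + C).sum +
      D.prof (N 1) ∧ t ≤ N l.prod + E.sup N * l.length ∧ N l.prod ≤ t + E.sup N * l.length := by
    induction l with
    | nil => exact ⟨N 1, by simp⟩
    | cons x l ih =>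
      obtain ⟨t, h1, h2, h3⟩ := ih
      rw [List.prod_cons, List.length_cons, mul_add, mul_one]
      have n1 := N_mul x l.prod
      have n2 := N_mul x⁻¹ (x * l.prod)
      have n3 := N_mul (x * l.prod) l.prod⁻¹
      rw [inv_mul_cancel_left, N_inv] at n2
      rw [mul_inv_cancel_right, N_inv] at n3
      by_cases hx : x ∈ E
      · have := Finset.le_sup (f := N) hx
        exact ⟨t, by simpa [hx] using h1, by omega, by omega⟩
      · simp only [List.map_cons, List.sum_cons, if_neg hx]
        obtain ⟨t', g1, g2, g3, g4, g5⟩ : ∃ t' : ℕ, t' ≤ t + N x ∧ t ≤ t' + N x ∧ N x ≤ t + t' ∧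
            t' ≤ N (x * l.prod) + E.sup N * l.length ∧
            N (x * l.prod) ≤ t' + E.sup N * l.length := by
          -- The true new length is clamped to the interval [|t - N x|, t + N x], so that t, N x and
          -- t' form a triangle. Clamping does not increase the error, as the true lengths form a
          -- triangle too.
          refine ⟨max (max (t - N x) (N x - t)) (min (t + N x) (N (x * l.prod))), ?_, ?_, ?_, ?_, ?_⟩
            <;> omega
        refine ⟨t', ?_, by omega, by omega⟩
        have := h t (N x) t' (by omega) (by omega) (by omega)
        have := (N_a x).2
        linarith [le_abs_self H, D.prof_nonneg 0, D.prof_nonneg (N 1)]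
  obtain ⟨t, h1, h2, h3⟩ := key
  have h4 := D.prof_le_of_close h3 h2
  have h5 := (N_a l.prod).1
  linarith [abs_nonneg H, D.prof_nonneg 0]

theorem hasWordBound : D.HasWordBound := by
  by_cases h : Tendsto D.prof atTop atTop
  · by_cases hL : D.IsLinelike
    · exact EmbedsInLine.hasWordBound D (IsLinelike.embedsInLine D hL h)
    · exact HasTriangles.hasWordBound D (D.hasTriangles_of_not_isLinelike hL h)
  · rw [tendsto_atTop_atTop] at h
    push Not at h
    obtain ⟨b, hb⟩ := h
    exact EmbedsInLine.hasWordBound D (D.embedsInLine_of_frequently (b := b) fun N => by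
      obtain ⟨L, h1, h2⟩ := hb N
      exact ⟨L, h1, h2.le⟩)

end ShellLength

/-! ### Word bounds for weights -/

namespace SymmWeight

variable {G : Type*} [Group G] (ν : SymmWeight G)

/-- Words are bounded by the product of the weights of their letters, where letters from a finite
set count for nothing and the others for a constant multiple of their weight, up to a
subexponential factor in the number of letters. -/
def HasSubexponentialWordBound : Prop :=
  ∃ C : ℝ, 0 ≤ C ∧ ∀ E : Finset G, ∃ b : ℕ → ℝ, Tendsto (fun n : ℕ => b n / n) atTop (𝓝 0) ∧
    ∀ l : List G, Real.log (ν l.prod) ≤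
      (l.map fun x => by classical exact if x ∈ E then 0 else Real.log (ν x) + C).sum + b l.length

theorem log_nonneg (x : G) : 0 ≤ Real.log (ν x) := Real.log_nonneg (ν.one_le' x)

theorem hasSubexponentialWordBound_of_bounded {M : ℝ} (hM : ∀ x, ν x ≤ M) :
    ν.HasSubexponentialWordBound := by
  classical
  refine ⟨0, le_rfl, fun E => ⟨fun _ => Real.log M, tendsto_const_div_atTop_nhds_zero_nat _,
    fun l => ?_⟩⟩
  have h1 : Real.log (ν l.prod) ≤ Real.log M := Real.log_le_log (ν.pos _) (hM _)
  have h2 : 0 ≤ (l.map fun x => if x ∈ E then 0 else Real.log (ν x) + 0).sum := by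
    refine List.sum_nonneg fun a ha => ?_
    obtain ⟨x, -, rfl⟩ := List.mem_map.1 ha
    split_ifs
    · exact le_rfl
    · simpa using ν.log_nonneg x
  simpa using add_le_add h2 h1

/-! ### Word bounds from the two growth hypotheses. -/

section Growth

variable {ν} {V : Set G}

theorem pow_subset_pow_of_one_mem (hone : (1 : G) ∈ V) {m n : ℕ} (h : m ≤ n) : V ^ m ⊆ V ^ n :=
  Set.pow_right_monotone hone h

theorem exists_bound_on_pow (hone : (1 : G) ∈ V)
    (hugrs : Tendsto (fun n : ℕ => (⨆ x ∈ V ^ n, ENNReal.ofReal (ν x)) ^ (1 / (n : ℝ)))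
      atTop (𝓝 1)) (m : ℕ) : (⨆ x ∈ V ^ m, ENNReal.ofReal (ν x)) ≠ ∞ := by
  -- Requiring n ≥ m + 1 excludes n = 0, where the exponent is 0 and ∞ ^ 0 = 1.
  obtain ⟨n, hn, hm⟩ := ((hugrs.eventually_lt_const (u := ∞) ENNReal.one_lt_top).and
    (eventually_ge_atTop (m + 1))).exists
  have h1 : (⨆ x ∈ V ^ n, ENNReal.ofReal (ν x)) ≠ ∞ := fun h => by
    rw [h, ENNReal.top_rpow_of_pos (by have : 0 < n := by omega
                                       positivity)] at hn
    exact lt_irrefl _ hn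
  exact ne_top_of_le_ne_top h1
    (biSup_mono (pow_subset_pow_of_one_mem hone (by omega)))

theorem le_toReal_biSup {n : ℕ} (h : (⨆ x ∈ V ^ n, ENNReal.ofReal (ν x)) ≠ ∞) {x : G}
    (hx : x ∈ V ^ n) : ν x ≤ (⨆ x ∈ V ^ n, ENNReal.ofReal (ν x)).toReal :=
  (ENNReal.ofReal_le_iff_le_toReal h).1 (le_biSup (fun x => ENNReal.ofReal (ν x)) hx)

theorem tendsto_log_biSup_div (hone : (1 : G) ∈ V)
    (hugrs : Tendsto (fun n : ℕ => (⨆ x ∈ V ^ n, ENNReal.ofReal (ν x)) ^ (1 / (n : ℝ)))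
      atTop (𝓝 1)) :
    Tendsto (fun n : ℕ => Real.log (⨆ x ∈ V ^ n, ENNReal.ofReal (ν x)).toReal / n)
      atTop (𝓝 0) := by
  have h1 := (ENNReal.tendsto_toReal ENNReal.one_ne_top).comp hugrs
  have h2 := ((Real.continuousAt_log (x := (1 : ℝ≥0∞).toReal) (by simp)).tendsto).comp h1
  simp only [ENNReal.toReal_one, Real.log_one] at h2
  refine h2.congr fun n => ?_
  have hpos : 0 < (⨆ x ∈ V ^ n, ENNReal.ofReal (ν x)).toReal :=
    (ν.pos 1).trans_le (le_toReal_biSup (exists_bound_on_pow hone hugrs n)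
      (Set.one_mem_pow hone))
  simp only [Function.comp_apply, ← ENNReal.toReal_rpow]
  rw [Real.log_rpow hpos]
  ring

open Classical in
/-- The length function and profile of a weight that is almost constant on spheres. -/
noncomputable def shellLength (hone : (1 : G) ∈ V) (hgen : (⋃ n : ℕ, V ^ n) = Set.univ)
    (hugrs : Tendsto (fun n : ℕ => (⨆ x ∈ V ^ n, ENNReal.ofReal (ν x)) ^ (1 / (n : ℝ)))
      atTop (𝓝 1))
    (C : ℝ≥0) (hcomp : ∀ n : ℕ, (⨆ x ∈ V ^ (n + 1) \ V ^ n, ENNReal.ofReal (ν x)) ≤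
        (C : ℝ≥0∞) * ⨅ x ∈ V ^ (n + 1) \ V ^ n, ENNReal.ofReal (ν x))
    (hne : ∀ n, ∃ x, x ∈ V ^ (n + 1) ∧ x ∉ V ^ n) : ShellLength G :=
  have hmem : ∀ x, ∃ n, x ∈ V ^ n := fun x => by
    simpa using (hgen ▸ Set.mem_univ x : x ∈ ⋃ n : ℕ, V ^ n)
  have hle : ∀ x n, Nat.find (hmem x) ≤ n ↔ x ∈ V ^ n := fun x n =>
    ⟨fun h => pow_subset_pow_of_one_mem hone h (Nat.find_spec (hmem x)), fun h => Nat.find_le h⟩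
  have hex : ∀ n, ∃ x, Nat.find (hmem x) = n := fun n => by
    cases n with
    | zero => exact ⟨1, Nat.le_zero.1 ((hle 1 0).2 (by simp))⟩
    | succ n =>
      obtain ⟨x, h1, h2⟩ := hne n
      rw [← hle] at h1 h2
      exact ⟨x, by omega⟩
  have hzero : ∀ x, Nat.find (hmem x) = 0 → x = 1 := fun x hx => by
    simpa using (hle x 0).1 hx.le
  have hmul : ∀ x y, Nat.find (hmem (x * y)) ≤ Nat.find (hmem x) + Nat.find (hmem y) :=
    fun x y => (hle _ _).2 (by
      rw [pow_add]
      exact Set.mul_mem_mul ((hle _ _).1 le_rfl) ((hle _ _).1 le_rfl))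
  { a := fun x => Real.log (ν x)
    len := fun x => Nat.find (hmem x)
    prof := fun n => Real.log (ν (hex n).choose)
    bnd := fun n => Real.log (⨆ x ∈ V ^ n, ENNReal.ofReal (ν x)).toReal
    c := Real.log (max C 1)
    a_mul := fun x y => by
      rw [← Real.log_mul (ν.pos x).ne' (ν.pos y).ne']
      exact Real.log_le_log (ν.pos _) (ν.mul_le' x y)
    a_inv := fun x => by rw [ν.inv']
    len_one := Nat.le_zero.1 ((hle 1 0).2 (by simp))
    eq_one_of_len := hzero
    len_mul := hmul
    exists_split := fun x m n hx => by
      have h1 := (hle x (m + n)).1 hx.le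
      rw [pow_add] at h1
      obtain ⟨y, hy, z, hz, rfl⟩ := Set.mem_mul.1 h1
      have h2 := hmul y z
      rw [← hle] at hy hz
      exact ⟨y, z, rfl, by omega, by omega⟩
    exists_len := hex
    near := fun x => by
      have hC : (1 : ℝ) ≤ max C 1 := le_max_right _ _
      have key : ∀ x y, Nat.find (hmem x) = Nat.find (hmem y) →
          Real.log (ν x) ≤ Real.log (max C 1) + Real.log (ν y) := fun x y hxy => by
        rw [← Real.log_mul (by positivity) (ν.pos y).ne']
        refine Real.log_le_log (ν.pos x) ?_
        rcases h : Nat.find (hmem x) with _ | n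
        · rw [hzero x h, hzero y (hxy.symm.trans h)]
          exact le_mul_of_one_le_left (ν.nonneg 1) hC
        · have sh : ∀ z, Nat.find (hmem z) = n + 1 → z ∈ V ^ (n + 1) \ V ^ n := fun z hz =>
            ⟨(hle _ _).1 hz.le, fun h' => by
              have := (hle _ _).2 h'
              omega⟩
          have h1 : ENNReal.ofReal (ν x) ≤ C * ENNReal.ofReal (ν y) :=
            (le_biSup (fun x => ENNReal.ofReal (ν x)) (sh x h)).trans ((hcomp n).trans
              (mul_le_mul_right (biInf_le (fun x => ENNReal.ofReal (ν x))
                (sh y (hxy.symm.trans h))) _))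
          rw [← ENNReal.ofReal_coe_nnreal, ← ENNReal.ofReal_mul C.coe_nonneg,
            ENNReal.ofReal_le_ofReal_iff (mul_nonneg C.coe_nonneg (ν.nonneg y))] at h1
          exact h1.trans (mul_le_mul_of_nonneg_right (le_max_left _ _) (ν.nonneg y))
      have h := (hex (Nat.find (hmem x))).choose_spec
      have h1 := key _ _ h
      have h2 := key _ _ h.symm
      rw [abs_le]
      constructor <;> linarith
    prof_nonneg := fun n => ν.log_nonneg _
    bnd_mono := fun m n h => by
      refine Real.log_le_log ((ν.pos 1).trans_le
        (le_toReal_biSup (exists_bound_on_pow hone hugrs m) (Set.one_mem_pow hone))) ?_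
      exact ENNReal.toReal_mono (exists_bound_on_pow hone hugrs n)
        (biSup_mono (pow_subset_pow_of_one_mem hone h))
    prof_le := fun n => by
      refine Real.log_le_log (ν.pos _) (le_toReal_biSup (exists_bound_on_pow hone hugrs n) ?_)
      exact (hle _ _).1 (hex n).choose_spec.le }

theorem hasSubexponentialWordBound (hone : (1 : G) ∈ V) (hgen : (⋃ n : ℕ, V ^ n) = Set.univ)
    (hugrs : Tendsto (fun n : ℕ => (⨆ x ∈ V ^ n, ENNReal.ofReal (ν x)) ^ (1 / (n : ℝ)))
      atTop (𝓝 1))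
    (hcomp : ∃ C : ℝ≥0, ∀ n : ℕ, (⨆ x ∈ V ^ (n + 1) \ V ^ n, ENNReal.ofReal (ν x)) ≤
        (C : ℝ≥0∞) * ⨅ x ∈ V ^ (n + 1) \ V ^ n, ENNReal.ofReal (ν x)) :
    ν.HasSubexponentialWordBound := by
  obtain ⟨C, hC⟩ := hcomp
  -- The length must attain every value for the profile to be defined. Otherwise the powers of V
  -- stabilize, G is a single V ^ m, and ν is bounded.
  by_cases hne : ∀ n, ∃ x, x ∈ V ^ (n + 1) ∧ x ∉ V ^ n
  · let D := shellLength hone hgen hugrs C hC hne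
    obtain ⟨C', hC', h⟩ := D.hasWordBound
    refine ⟨C', hC', fun E => ?_⟩
    obtain ⟨K, hK⟩ := h E
    -- K + 1 instead of K keeps the argument tending to infinity when K = 0.
    refine ⟨fun n => D.bnd ((K + 1) * n) + C', ?_, fun l => ?_⟩
    · have h1 : Tendsto (fun n : ℕ => (K + 1) * n) atTop atTop :=
        tendsto_id.const_mul_atTop' (Nat.succ_pos K)
      have h2 := ((tendsto_log_biSup_div hone hugrs).comp h1).const_mul ((K : ℝ) + 1)
      have h3 := h2.add (tendsto_const_div_atTop_nhds_zero_nat C')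
      rw [mul_zero, zero_add] at h3
      refine h3.congr fun n => ?_
      rcases Nat.eq_zero_or_pos n with rfl | hn
      · simp
      · simp only [Function.comp_apply, D, shellLength]
        push_cast
        field_simp
    · have := D.bnd_mono (Nat.mul_le_mul_right l.length (Nat.le_succ K))
      exact (hK l).trans
        ((add_assoc _ _ _).trans_le (add_le_add le_rfl (add_le_add this le_rfl)))
  · push Not at hne
    obtain ⟨m, hm⟩ := hne
    have hall : ∀ n, V ^ n ⊆ V ^ m := fun n => by
      induction n with
      | zero => exact pow_subset_pow_of_one_mem hone (Nat.zero_le m)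
      | succ n ih =>
        rw [pow_succ]
        exact (Set.mul_subset_mul_right ih).trans ((pow_succ V m).symm.subset.trans hm)
    refine ν.hasSubexponentialWordBound_of_bounded fun x =>
      le_toReal_biSup (exists_bound_on_pow hone hugrs m) ?_
    obtain ⟨n, hn⟩ := Set.mem_iUnion.1 (hgen ▸ Set.mem_univ x : x ∈ ⋃ n : ℕ, V ^ n)
    exact hall n hn

end Growth

end SymmWeight

/-! ### Transfer of symmetry along a homomorphism that controls the spectrum -/

section Transfer

/-- Taking n-th roots removes m and M, and Gelfand's formula turns ‖x ^ n‖ into the spectral radius.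
-/
theorem norm_le_of_mul_pow_le {𝔸 : Type*} [NormedRing 𝔸] [NormedAlgebra ℂ 𝔸] [CompleteSpace 𝔸]
    [Nontrivial 𝔸] {x : 𝔸} {w : ℂ} {m M ρ : ℝ} (hm : 0 < m) (hρ : 0 ≤ ρ)
    (hσ : ∀ t ∈ spectrum ℂ x, ‖t‖ ≤ ρ) (h : ∀ n : ℕ, m * ‖w‖ ^ n ≤ M * ‖x ^ n‖) : ‖w‖ ≤ ρ := by
  by_contra! hlt
  obtain ⟨r, h1, h2⟩ := exists_between hlt
  have hr : 0 < r := hρ.trans_lt h1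
  have h3 : spectralRadius ℂ x < ENNReal.ofReal r := by
    refine spectrum.spectralRadius_lt_of_forall_lt x fun t ht => ?_
    rw [← NNReal.coe_lt_coe, coe_nnnorm, Real.coe_toNNReal _ hr.le]
    exact (hσ t ht).trans_lt h1
  have h4 := (spectrum.pow_norm_pow_one_div_tendsto_nhds_spectralRadius x).eventually_lt_const h3
  have h5 := ((tendsto_pow_atTop_atTop_of_one_lt ((one_lt_div hr).2 h2)).eventually_gt_atTop
    (|M| / m))
  obtain ⟨n, ⟨h6, h7⟩, hn⟩ := ((h4.and h5).and (eventually_gt_atTop 0)).exists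
  rw [ENNReal.ofReal_lt_ofReal_iff hr] at h6
  have h8 : ‖x ^ n‖ ≤ r ^ n := by
    have := pow_le_pow_left₀ (by positivity) h6.le n
    rwa [one_div, Real.rpow_inv_natCast_pow (norm_nonneg _) hn.ne'] at this
  rw [div_pow, div_lt_div_iff₀ hm (by positivity)] at h7
  have h9 := h n
  have h10 : M * ‖x ^ n‖ ≤ |M| * r ^ n :=
    mul_le_mul (le_abs_self M) h8 (norm_nonneg _) (abs_nonneg M)
  linarith

/-- `h (h - c)ⁿ`, computed without a unit. -/
def mulSubPow {B : Type*} [NonUnitalRing B] [Module ℂ B] (h : B) (c : ℂ) : ℕ → B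
  | 0 => h
  | n + 1 => mulSubPow h c n * h - c • mulSubPow h c n

theorem inr_mulSubPow {B : Type*} [NonUnitalRing B] [Module ℂ B] [IsScalarTower ℂ B B]
    [SMulCommClass ℂ B B] (h : B) (c : ℂ) (n : ℕ) :
    ((mulSubPow h c n : B) : Unitization ℂ B) =
      (h : Unitization ℂ B) * ((h : Unitization ℂ B) - algebraMap ℂ (Unitization ℂ B) c) ^ n := by
  induction n with
  | zero => simp [mulSubPow]
  | succ n ih =>
    rw [mulSubPow, Unitization.inr_sub, Unitization.inr_mul, Unitization.inr_smul, ih, pow_succ,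
      ← mul_assoc, mul_sub, ← Algebra.commutes, Algebra.smul_def]

theorem map_mulSubPow {B B₁ : Type*} [NonUnitalRing B] [Module ℂ B] [NonUnitalRing B₁]
    [Module ℂ B₁] (Φ : B →ₙₐ[ℂ] B₁) (h : B) (c : ℂ) (n : ℕ) :
    Φ (mulSubPow h c n) = mulSubPow (Φ h) c n := by
  induction n with
  | zero => rfl
  | succ n ih => simp only [mulSubPow, map_sub, map_mul, map_smul, ih]

theorem mul_pow_mem_quasispectrum {B : Type*} [NonUnitalRing B] [Module ℂ B] [IsScalarTower ℂ B B]
    [SMulCommClass ℂ B B] {h : B} {z : ℂ} (hz : z ∈ quasispectrum ℂ h) (c : ℂ) (n : ℕ) :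
    z * (z - c) ^ n ∈ quasispectrum ℂ (mulSubPow h c n) := by
  rw [Unitization.quasispectrum_eq_spectrum_inr] at hz ⊢
  have := spectrum.subset_polynomial_aeval (h : Unitization ℂ B)
    (Polynomial.X * (Polynomial.X - Polynomial.C c) ^ n) ⟨z, hz, rfl⟩
  simpa [inr_mulSubPow] using this

theorem spectrum_toLp {B : Type*} [NonUnitalNormedRing B] [NormedSpace ℂ B]
    [IsScalarTower ℂ B B] [SMulCommClass ℂ B B] (b : Unitization ℂ B) : spectrum ℂ (WithLp.toLp 1 b) = spectrum ℂ b :=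
  (AlgEquiv.spectrum_eq (WithLp.unitizationAlgEquiv (𝕜 := ℂ) (A := B) ℂ) (WithLp.toLp 1 b)).symm

variable {B B₁ : Type*} [NonUnitalNormedRing B] [StarRing B] [NormedStarGroup B] [NormedSpace ℂ B]
  [IsScalarTower ℂ B B] [SMulCommClass ℂ B B] [StarModule ℂ B] [CompleteSpace B]
  [NonUnitalNormedRing B₁] [StarRing B₁] [NormedStarGroup B₁] [NormedSpace ℂ B₁]
  [IsScalarTower ℂ B₁ B₁] [SMulCommClass ℂ B₁ B₁] [StarModule ℂ B₁] [CompleteSpace B₁]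

/-- If `Φ` maps into a symmetric Banach `*`-algebra and `‖Φ k‖` bounds the spectrum of `k`, then
the domain of `Φ` is symmetric. -/
theorem IsSymmetricBanachStarAlgebra.of_hom (hB₁ : IsSymmetricBanachStarAlgebra B₁)
    (Φ : B →⋆ₙₐ[ℂ] B₁) (hΦ : ∀ k, ∀ z ∈ quasispectrum ℂ k, ‖z‖ ≤ ‖Φ k‖) :
    IsSymmetricBanachStarAlgebra B := by
  intro b z hz
  set h := star b * b with hh
  rcases eq_or_ne z 0 with rfl | hz0
  · simp
  let H : WithLp 1 (Unitization ℂ B₁) := WithLp.toLp 1 (Φ h : Unitization ℂ B₁)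
  have hH : spectrum ℂ H = quasispectrum ℂ (Φ h) := by
    rw [Unitization.quasispectrum_eq_spectrum_inr, ← spectrum_toLp]
  let R := ‖H‖ * ‖(1 : WithLp 1 (Unitization ℂ B₁))‖
  have hspec : ∀ t ∈ spectrum ℂ H, 0 ≤ t.re ∧ t.im = 0 ∧ t.re ≤ R := by
    intro t ht
    have h1 := spectrum.norm_le_norm_mul_of_mem ht
    rw [hH, hh, map_mul, map_star] at ht
    have h2 := hB₁ (Φ b) t ht
    exact ⟨h2.1, h2.2, (Complex.re_le_norm t).trans h1⟩
  -- The extra factor h keeps h (h - c)ⁿ inside the non-unital algebra where `hΦ` applies. It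
  -- contributes only the constants ‖z‖ and ‖H‖, which disappear in the limit.
  have key : ∀ (c : ℂ) (ρ : ℝ), 0 ≤ ρ → (∀ t : ℝ, 0 ≤ t → t ≤ R → ‖(t : ℂ) - c‖ ≤ ρ) →
      ‖z - c‖ ≤ ρ := by
    intro c ρ hρ hc
    have : Nontrivial (WithLp 1 (Unitization ℂ B₁)) :=
      (WithLp.equiv 1 (Unitization ℂ B₁)).nontrivial
    refine norm_le_of_mul_pow_le (x := H - algebraMap ℂ _ c) (M := ‖H‖) (norm_pos_iff.2 hz0) hρ
      (fun t ht => ?_) fun n => ?_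
    · rw [← spectrum.sub_singleton_eq, Set.sub_singleton] at ht
      obtain ⟨s, hs, rfl⟩ := ht
      obtain ⟨h1, h2, h3⟩ := hspec s hs
      have : s = (s.re : ℂ) := Complex.ext rfl (by simpa using h2)
      rw [this]
      exact hc _ h1 h3
    · rw [← norm_pow, ← norm_mul]
      refine (hΦ _ _ (mul_pow_mem_quasispectrum hz c n)).trans ?_
      have e : Φ (mulSubPow h c n) = mulSubPow (Φ h) c n :=
        map_mulSubPow (Φ : B →ₙₐ[ℂ] B₁) h c n
      rw [e, ← WithLp.unitization_norm_inr (𝕜 := ℂ), inr_mulSubPow]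
      exact norm_mul_le H ((H - algebraMap ℂ _ c) ^ n)
  have hR : 0 ≤ R := by positivity
  constructor
  -- The disc centred at R with radius R lies in the right half plane.
  · have h1 := key R R hR fun t h0 ht => by
      rw [← Complex.ofReal_sub, Complex.norm_real, Real.norm_eq_abs, abs_le]
      constructor <;> linarith
    have h2 := (abs_le.1 ((Complex.abs_re_le_norm (z - R)).trans h1)).1
    simp only [Complex.sub_re, Complex.ofReal_re] at h2
    linarith
  -- Discs centred at s i that contain [0, R] flatten onto the real axis as s tends to ±∞. The value
  -- of s below makes -2 s Im z equal to 2 (R² + 1), which exceeds R².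
  · have h1 : ∀ s : ℝ, z.re ^ 2 + (z.im - s) ^ 2 ≤ R ^ 2 + s ^ 2 := fun s => by
      have h2 := key (s * Complex.I) (√(R ^ 2 + s ^ 2)) (Real.sqrt_nonneg _) fun t h0 ht => by
        rw [Complex.norm_eq_sqrt_sq_add_sq]
        refine Real.sqrt_le_sqrt ?_
        simp
        nlinarith
      rw [Complex.norm_eq_sqrt_sq_add_sq, Real.sqrt_le_sqrt_iff (by positivity)] at h2
      simpa using h2
    by_contra hne
    have h2 := h1 ((R ^ 2 + 1) * (-z.im⁻¹))
    have h3 : z.im * z.im⁻¹ = 1 := mul_inv_cancel₀ hne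
    nlinarith [sq_nonneg z.re, sq_nonneg z.im]

end Transfer

/-! ### The spectrum in a weighted crossed product -/

namespace TwistedCrossedProduct

variable {G A : Type*} [Group G] [NonUnitalCStarAlgebra A]
variable {S : TwistedCStarSystem G A} {ν : SymmWeight G}

/-- The power `k ^ (n + 1)`. -/
noncomputable def powSucc (k : TwistedCrossedProduct S ν) : ℕ → TwistedCrossedProduct S ν
  | 0 => k
  | n + 1 => powSucc k n * k

theorem inr_powSucc (k : TwistedCrossedProduct S ν) (n : ℕ) :
    ((powSucc k n : TwistedCrossedProduct S ν) : Unitization ℂ (TwistedCrossedProduct S ν)) =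
      (k : Unitization ℂ (TwistedCrossedProduct S ν)) ^ (n + 1) := by
  induction n with
  | zero => simp [powSucc]
  | succ n ih => rw [powSucc, Unitization.inr_mul, ih, ← pow_succ]

theorem norm_pow_le_of_mem_quasispectrum {k : TwistedCrossedProduct S ν} {z : ℂ}
    (hz : z ∈ quasispectrum ℂ k) (n : ℕ) : ‖z‖ ^ (n + 1) ≤ ‖powSucc k n‖ := by
  rw [Unitization.quasispectrum_eq_spectrum_inr] at hz
  have h1 := spectrum.pow_mem_pow _ (n + 1) hz
  rw [← inr_powSucc, ← spectrum_toLp] at h1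
  have h2 := spectrum.norm_le_norm_mul_of_mem h1
  rw [WithLp.unitization_norm_inr, norm_pow] at h2
  have h3 : ‖(1 : WithLp 1 (Unitization ℂ (TwistedCrossedProduct S ν)))‖ = 1 := by
    rw [WithLp.unitization_norm_def]
    change ‖(1 : Unitization ℂ (TwistedCrossedProduct S ν)).fst‖ +
      ‖(1 : Unitization ℂ (TwistedCrossedProduct S ν)).snd‖ = 1
    simp
  rwa [h3, mul_one] at h2

/-! ### Word weights and the spectral radius. -/

/-- The infimum of the products of the weights `w` over words of length `n` with value `x`. -/
noncomputable def wordWeight (w : G → ℝ≥0∞) (n : ℕ) (x : G) : ℝ≥0∞ :=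
  ⨅ l : {l : List G // l.length = n ∧ l.prod = x}, (l.1.map w).prod

theorem wordWeight_mul_le {w : G → ℝ≥0∞} (h0 : ∀ x, w x ≠ 0) (htop : ∀ x, w x ≠ ∞) (n : ℕ)
    (x y : G) : wordWeight w (n + 1) (x * y) ≤ wordWeight w n x * w y := by
  rw [wordWeight, wordWeight, ENNReal.iInf_mul_of_ne (h0 y) (htop y)]
  refine le_iInf fun l => ?_
  refine iInf_le_of_le ⟨l.1 ++ [y], by simp [l.2.1], by simp [l.2.2]⟩ ?_
  simp

/-- The weight w need not be submultiplicative, so powers of k are not controlled by w itself. Word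
weights satisfy the graded inequality `wordWeight_mul_le`, which suffices for induction on
convolution powers. -/
theorem tsum_wordWeight_le {w : G → ℝ≥0∞} (h0 : ∀ x, w x ≠ 0) (htop : ∀ x, w x ≠ ∞)
    (k : TwistedCrossedProduct S ν) (n : ℕ) :
    ∑' x, wordWeight w (n + 1) x * ‖powSucc k n x‖ₑ ≤ (∑' x, w x * ‖k x‖ₑ) ^ (n + 1) := by
  induction n with
  | zero =>
    rw [zero_add, pow_one]
    refine ENNReal.tsum_le_tsum fun x => mul_le_mul_left ?_ _
    exact iInf_le_of_le ⟨[x], by simp, by simp⟩ (by simp)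
  | succ n ih =>
    have h1 : ∀ x, wordWeight w (n + 1 + 1) x * ‖powSucc k (n + 1) x‖ₑ ≤
        ∑' y, (wordWeight w (n + 1) y * ‖powSucc k n y‖ₑ) *
          (w (y⁻¹ * x) * ‖k (y⁻¹ * x)‖ₑ) := fun x => by
      refine (mul_le_mul_right (enorm_tsum_le_tsum_enorm
        (f := convTerm S (powSucc k n).toFun k.toFun x)) _).trans ?_
      rw [← ENNReal.tsum_mul_left]
      refine ENNReal.tsum_le_tsum fun y => ?_
      have h2 := wordWeight_mul_le h0 htop (n + 1) y (y⁻¹ * x)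
      rw [mul_inv_cancel_left] at h2
      have h3 : ‖convTerm S (powSucc k n).toFun k.toFun x y‖ₑ ≤
          ‖powSucc k n y‖ₑ * ‖k (y⁻¹ * x)‖ₑ := by
        rw [← ofReal_norm, ← ofReal_norm, ← ofReal_norm, ← ENNReal.ofReal_mul (norm_nonneg _)]
        exact ENNReal.ofReal_le_ofReal (norm_convTerm_le _ _ _ _)
      exact (mul_le_mul' h2 h3).trans_eq (by ring)
    refine (ENNReal.tsum_le_tsum h1).trans ?_
    rw [ENNReal.tsum_comm]
    simp_rw [ENNReal.tsum_mul_left]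
    have h4 : ∀ y : G, ∑' x, w (y⁻¹ * x) * ‖k (y⁻¹ * x)‖ₑ = ∑' x, w x * ‖k x‖ₑ := fun y =>
      (Equiv.mulLeft y⁻¹).tsum_eq fun x => w x * ‖k x‖ₑ
    simp_rw [h4]
    rw [ENNReal.tsum_mul_right, pow_succ]
    exact mul_le_mul_left ih _

theorem ofReal_norm_eq_tsum (k : TwistedCrossedProduct S ν) :
    ENNReal.ofReal ‖k‖ = ∑' x, ENNReal.ofReal (ν x) * ‖k x‖ₑ := by
  rw [norm_def, ENNReal.ofReal_tsum_of_nonneg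
    (fun x => mul_nonneg (ν.nonneg x) (norm_nonneg _)) k.summable_weight]
  exact tsum_congr fun x => by rw [ENNReal.ofReal_mul (ν.nonneg x), ofReal_norm]

theorem _root_.le_of_pow_le_exp_mul_pow {r s : ℝ} (hs : 0 ≤ s) {b : ℕ → ℝ}
    (hb : Tendsto (fun n : ℕ => b n / n) atTop (𝓝 0))
    (h : ∀ n : ℕ, r ^ (n + 1) ≤ Real.exp (b (n + 1)) * s ^ (n + 1)) : r ≤ s := by
  have h1 : Tendsto (fun n : ℕ => Real.exp (b (n + 1) / (n + 1 : ℕ)) * s) atTop (𝓝 (1 * s)) := by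
    refine Tendsto.mul_const s ?_
    have h2 := (Real.continuous_exp.tendsto 0).comp ((tendsto_add_atTop_iff_nat 1).2 hb)
    rwa [Real.exp_zero] at h2
  rw [one_mul] at h1
  refine ge_of_tendsto' h1 fun n => ?_
  by_contra! hlt
  have h3 := pow_lt_pow_left₀ hlt (by positivity) n.succ_ne_zero
  rw [mul_pow, ← Real.exp_nat_mul, Nat.succ_eq_add_one,
    mul_div_cancel₀ _ (by positivity : ((n + 1 : ℕ) : ℝ) ≠ 0)] at h3
  exact absurd (h n) (not_le.2 h3)

/-- For weights with subexponential word bounds the spectral radius does not exceed the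
unweighted `ℓ¹` norm. -/
theorem norm_le_tsum_norm_of_mem_quasispectrum (hν : ν.HasSubexponentialWordBound)
    {k : TwistedCrossedProduct S ν} {z : ℂ} (hz : z ∈ quasispectrum ℂ k) :
    ‖z‖ ≤ ∑' x, ‖k x‖ := by
  classical
  obtain ⟨C, hC, hν⟩ := hν
  -- Letters in E get weight 1 and the others e^C ν(x). The word bound compares ν with the word
  -- weights up to exp (b n), which disappears on taking roots. Since C does not depend on E, the
  -- tail term vanishes as E exhausts G.
  have key : ∀ E : Finset G, ‖z‖ ≤
      ∑' x, ‖k x‖ + Real.exp C * (‖k‖ - ∑ x ∈ E, ν x * ‖k x‖) := by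
    intro E
    obtain ⟨b, hb, hl⟩ := hν E
    let u : G → ℝ := fun x => if x ∈ E then 0 else Real.log (ν x) + C
    let w : G → ℝ≥0∞ := fun x => ENNReal.ofReal (Real.exp (u x))
    have hle : ∀ x, Real.exp (u x) * ‖k x‖ ≤ ‖k x‖ +
        Real.exp C * (ν x * ‖k x‖ - if x ∈ E then ν x * ‖k x‖ else 0) := fun x => by
      by_cases hx : x ∈ E
      · simp [u, hx]
      · simp only [u, if_neg hx, Real.exp_add, Real.exp_log (ν.pos x), sub_zero]
        linarith [norm_nonneg (k x)]
    have hE : HasSum (fun x => if x ∈ E then ν x * ‖k x‖ else 0) (∑ x ∈ E, ν x * ‖k x‖) := by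
      have : HasSum (fun x => if x ∈ E then ν x * ‖k x‖ else 0)
          (∑ x ∈ E, if x ∈ E then ν x * ‖k x‖ else 0) :=
        hasSum_sum_of_ne_finset_zero fun x hx => if_neg hx
      rwa [Finset.sum_congr rfl fun x hx => if_pos hx] at this
    have hsum := k.summable_norm.hasSum.add ((k.summable_weight.hasSum.sub hE).mul_left (Real.exp C))
    have hu0 : ∀ x, 0 ≤ Real.exp (u x) * ‖k x‖ := fun x => by positivity
    have hu : Summable fun x => Real.exp (u x) * ‖k x‖ := hsum.summable.of_nonneg_of_le hu0 hle
    refine le_trans (b := ∑' x, Real.exp (u x) * ‖k x‖) ?_ (hasSum_le hle hu.hasSum hsum)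
    refine le_of_pow_le_exp_mul_pow (tsum_nonneg hu0) hb fun n => ?_
    refine (norm_pow_le_of_mem_quasispectrum hz n).trans ?_
    rw [← ENNReal.ofReal_le_ofReal_iff (mul_nonneg (Real.exp_pos _).le (pow_nonneg (tsum_nonneg hu0) _)),
      ENNReal.ofReal_mul (Real.exp_pos _).le, ENNReal.ofReal_pow (tsum_nonneg hu0),
      ENNReal.ofReal_tsum_of_nonneg hu0 hu, ofReal_norm_eq_tsum]
    have h1 : ∀ x, ENNReal.ofReal (ν x) ≤
        ENNReal.ofReal (Real.exp (b (n + 1))) * wordWeight w (n + 1) x := fun x => by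
      have e0 : ENNReal.ofReal (Real.exp (b (n + 1))) ≠ 0 := by
        simpa using Real.exp_pos _
      rw [wordWeight, ENNReal.mul_iInf_of_ne e0 ENNReal.ofReal_ne_top]
      refine le_iInf fun ⟨l, h2, h3⟩ => ?_
      have h4 : (l.map w).prod = ENNReal.ofReal (Real.exp (l.map u).sum) := by
        clear h2 h3
        induction l with
        | nil => simp
        | cons x l ih =>
          rw [List.map_cons, List.prod_cons, ih, List.map_cons, List.sum_cons, Real.exp_add,
            ENNReal.ofReal_mul (Real.exp_pos _).le]
      rw [h4, ← ENNReal.ofReal_mul (Real.exp_pos _).le, ← Real.exp_add]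
      refine ENNReal.ofReal_le_ofReal ?_
      rw [← Real.log_le_iff_le_exp (ν.pos x), ← h3, ← h2, add_comm]
      exact hl l
    have h5 := tsum_wordWeight_le (w := w) (fun x => by simpa [w] using Real.exp_pos _)
      (fun x => ENNReal.ofReal_ne_top) k n
    calc ∑' x, ENNReal.ofReal (ν x) * ‖powSucc k n x‖ₑ
        ≤ ∑' x, ENNReal.ofReal (Real.exp (b (n + 1))) *
            (wordWeight w (n + 1) x * ‖powSucc k n x‖ₑ) :=
          ENNReal.tsum_le_tsum fun x => by
            rw [← mul_assoc]
            exact mul_le_mul_left (h1 x) _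
      _ ≤ _ := by
          rw [ENNReal.tsum_mul_left]
          refine mul_le_mul_right (h5.trans_eq ?_) _
          congr 1
          refine tsum_congr fun x => ?_
          rw [ENNReal.ofReal_mul (Real.exp_pos _).le, ofReal_norm]
  have h := (k.summable_weight.hasSum.const_sub ‖k‖).const_mul (Real.exp C)
  have h' := h.const_add (∑' x, ‖k x‖)
  rw [← norm_def, sub_self, mul_zero, add_zero] at h'
  exact ge_of_tendsto' h' key

end TwistedCrossedProduct

/-! ### States attaining the norm of a positive element -/

section States

open scoped ComplexOrder

variable {A : Type*} [CStarAlgebra A] [PartialOrder A] [StarOrderedRing A] [Nontrivial A]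

/-- Take a norming functional of ‖h‖ 1 + h, whose norm is 2 ‖h‖. Equality in the triangle inequality
forces f 1 = 1 and f h = ‖h‖, and a norm-one functional with f 1 = 1 is positive because ‖ ‖x‖ 1 - x
‖ ≤ ‖x‖ for x ≥ 0. -/
theorem exists_real_functional_of_nonneg {h : A} (hh : 0 ≤ h) (h0 : h ≠ 0) :
    ∃ f : StrongDual ℝ A, (∀ x, 0 ≤ x → 0 ≤ f x) ∧ f 1 = 1 ∧ f h = ‖h‖ := by
  have hpos : 0 < ‖h‖ := norm_pos_iff.2 h0
  have hnorm : ‖algebraMap ℝ A ‖h‖ + h‖ = ‖h‖ + ‖h‖ := by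
    refine le_antisymm ((norm_add_le _ _).trans (by simp)) ?_
    have h1 := (spectrum.add_mem_add_iff (s := ‖h‖)).2 (CStarAlgebra.norm_mem_spectrum_of_nonneg hh)
    have h2 := spectrum.norm_le_norm_of_mem h1
    rwa [Real.norm_of_nonneg (by positivity)] at h2
  obtain ⟨f, hf, hfx⟩ := exists_dual_vector ℝ (algebraMap ℝ A ‖h‖ + h) (by rw [hnorm]; positivity)
  have hle : ∀ x, f x ≤ ‖x‖ := fun x =>
    (le_abs_self _).trans ((f.le_opNorm x).trans_eq (by rw [hf, one_mul]))
  rw [hnorm, map_add, Algebra.algebraMap_eq_smul_one, map_smul, smul_eq_mul] at hfx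
  have h1 := hle 1
  rw [norm_one] at h1
  have h2 := hle h
  have hf1 : f 1 = 1 := by
    simp only [RCLike.ofReal_real_eq_id, id] at hfx
    nlinarith
  refine ⟨f, fun x hx => ?_, hf1, ?_⟩
  · rcases eq_or_ne x 0 with rfl | hx0
    · simp
    have h3 := hle (algebraMap ℝ A ‖x‖ - x)
    have h4 : ‖algebraMap ℝ A ‖x‖ - x‖ ≤ ‖x‖ := by
      have h5 : 0 ≤ algebraMap ℝ A ‖x‖ - x :=
        sub_nonneg.2 (IsSelfAdjoint.of_nonneg hx).le_algebraMap_norm_self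
      rw [CStarAlgebra.norm_le_iff_le_algebraMap _ (norm_nonneg x) h5]
      exact sub_le_self _ hx
    rw [map_sub, Algebra.algebraMap_eq_smul_one, map_smul, smul_eq_mul, hf1, ← Algebra.algebraMap_eq_smul_one] at h3
    linarith
  · simp only [RCLike.ofReal_real_eq_id, id] at hfx
    rw [hf1] at hfx
    linarith

theorem exists_state_of_nonneg {h : A} (hh : 0 ≤ h) (h0 : h ≠ 0) :
    ∃ φ : A →ₚ[ℂ] ℂ, φ 1 = 1 ∧ φ h = ‖h‖ := by
  obtain ⟨f, hf, hf1, hfh⟩ := exists_real_functional_of_nonneg hh h0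
  let g : A →ₗ[ℝ] ℝ := (f : A →ₗ[ℝ] ℝ) ∘ₗ (selfAdjoint.submodule ℝ A).subtype ∘ₗ realPart
  let φ : A →ₗ[ℂ] ℂ := Module.Dual.extendRCLike g
  have hφ : ∀ x, IsSelfAdjoint x → φ x = f x := fun x hx => by
    have h1 : g x = f x := by
      change f (realPart x : A) = f x
      rw [hx.coe_realPart]
    have h2 : g (Complex.I • x) = 0 := by
      change f (realPart (Complex.I • x) : A) = 0
      rw [realPart_I_smul, hx.imaginaryPart]
      simp
    have := Module.Dual.extendRCLike_apply (𝕜 := ℂ) g x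
    rw [this, h1]
    simp [h2]
  refine ⟨PositiveLinearMap.mk₀ φ fun x hx => ?_, ?_, ?_⟩
  · rw [hφ x (IsSelfAdjoint.of_nonneg hx)]
    exact_mod_cast hf x hx
  · change φ 1 = 1
    rw [hφ 1 (IsSelfAdjoint.one A), hf1]
    simp
  · change φ h = ‖h‖
    rw [hφ h (IsSelfAdjoint.of_nonneg hh), hfh]

/-- The GNS representations separate points isometrically. -/
theorem exists_gns_vector {a : A} (ha : a ≠ 0) :
    ∃ (φ : A →ₚ[ℂ] ℂ) (v : φ.GNS), ‖v‖ = 1 ∧ ‖φ.gnsNonUnitalStarAlgHom a v‖ = ‖a‖ := by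
  obtain ⟨φ, h1, h2⟩ := exists_state_of_nonneg (star_mul_self_nonneg a)
    (fun h => ha ((CStarRing.star_mul_self_eq_zero_iff a).1 h))
  refine ⟨φ, ((φ.toPreGNS 1 : φ.PreGNS) : φ.GNS), ?_, ?_⟩
  · rw [UniformSpace.Completion.norm_coe, ← sq_eq_sq₀ (norm_nonneg _) zero_le_one,
      ← Complex.ofReal_inj, Complex.ofReal_pow, φ.preGNS_norm_sq]
    simp [h1]
  · rw [φ.gnsNonUnitalStarAlgHom_apply_coe, UniformSpace.Completion.norm_coe,
      ← sq_eq_sq₀ (norm_nonneg _) (norm_nonneg _), ← Complex.ofReal_inj, Complex.ofReal_pow,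
      φ.preGNS_norm_sq, sq, ← CStarRing.norm_star_mul_self, ← h2]
    simp

end States

/-! ### The regular representation of a twisted system -/

namespace TwistedCStarSystem

open MultiplierFacts

variable {G A : Type*} [Group G] [NonUnitalCStarAlgebra A] (S : TwistedCStarSystem G A)

/-- The element `α_s(a) ω(s, x)`. -/
noncomputable def twist (s x : G) : A →ₗ[ℂ] A where
  toFun a := (S.ω s x : 𝓜(ℂ, A)).snd (S.α s a)
  map_add' a b := by simp
  map_smul' c a := by simp

theorem twist_apply (s x : G) (a : A) :
    S.twist s x a = (S.ω s x : 𝓜(ℂ, A)).snd (S.α s a) := rfl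

theorem norm_twist_le (s x : G) (a : A) : ‖S.twist s x a‖ ≤ ‖a‖ :=
  (norm_snd_le _ _).trans_eq (norm_aut _ _)

theorem twist_one (x : G) (a : A) : S.twist 1 x a = a := by
  rw [twist_apply, S.ω_one_left, TwistedCrossedProduct.α_one]
  simp

/-- This is the cocycle identity. Since α_s(a) ω(s, x) is again in A, no extension of
representations to multipliers is needed. -/
theorem twist_mul (s x z : G) (a b : A) : S.twist s x a * S.twist (s * x) z b =
    S.twist s (x * z) ((S.ω x z : 𝓜(ℂ, A)).snd (a * S.α x b)) := by
  apply coe_inj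
  have hα := S.α_comp s x b
  have hc := S.cocycle s x z
  simp only [twist_apply, coe_snd_apply, coe_mul, ← extend_coe (S.α s), extend_mul]
  simp only [extend_coe, mul_assoc] at hα ⊢
  rw [← hc, hα]
  simp only [mul_assoc]
  rw [← mul_assoc (star (S.ω s x : 𝓜(ℂ, A))), TwistedCrossedProduct.star_mul_ω, one_mul]

theorem star_twist (t x : G) (a : A) : star (S.twist (t * x) x⁻¹ a) =
    S.twist t x ((star (S.ω x x⁻¹ : 𝓜(ℂ, A))).fst (star (S.α x a))) := by
  apply coe_inj
  have hα := S.α_comp t x (star a)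
  have hc := S.cocycle t x x⁻¹
  rw [mul_inv_cancel, S.ω_one_right, OneMemClass.coe_one, mul_one] at hc
  simp only [twist_apply, coe_snd_apply, coe_fst_apply, coe_star,
    ← extend_coe (S.α t), extend_mul, extend_star, ← map_star]
  simp only [extend_coe, ← hc, hα]
  simp only [star_mul, mul_assoc, TwistedCrossedProduct.star_mul_ω, mul_one]
  rw [← mul_assoc (star (S.ω t x : 𝓜(ℂ, A))), TwistedCrossedProduct.star_mul_ω, one_mul,
    map_star, coe_star]

section Representation

theorem summable_sq_translate {H : Type*} [NormedAddCommGroup H] (ξ : lp (fun _ : G => H) 2) (x : G) :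
    Summable fun s => ‖ξ (s * x)‖ ^ 2 := by
  have h := (memℓp_gen_iff (p := 2) (by simp)).1 (lp.memℓp ξ)
  simp only [ENNReal.toReal_ofNat, Real.rpow_ofNat] at h
  have h' : Summable ((fun s => ‖ξ s‖ ^ 2) ∘ Equiv.mulRight x) :=
    (Equiv.mulRight x).summable_iff.2 h
  exact h'

theorem tsum_sq_translate {H : Type*} [NormedAddCommGroup H] (ξ : lp (fun _ : G => H) 2) (x : G) :
    ∑' s, ‖ξ (s * x)‖ ^ 2 = ‖ξ‖ ^ 2 := by
  have h := lp.norm_rpow_eq_tsum (p := 2) (by simp) ξ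
  simp only [ENNReal.toReal_ofNat, Real.rpow_ofNat] at h
  rw [h]
  exact (Equiv.mulRight x).tsum_eq fun s => ‖ξ s‖ ^ 2

variable {H : Type*} [NormedAddCommGroup H] [InnerProductSpace ℂ H] [CompleteSpace H]
  (π : A →⋆ₙₐ[ℂ] (H →L[ℂ] H))

theorem norm_rep_twist_le (s x : G) (a : A) (v : H) :
    ‖π (S.twist s x a) v‖ ≤ ‖a‖ * ‖v‖ :=
  ((π (S.twist s x a)).le_opNorm v).trans (mul_le_mul_of_nonneg_right
    ((NonUnitalStarAlgHom.norm_apply_le π _).trans (S.norm_twist_le s x a)) (norm_nonneg _))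

theorem summable_sq_regular (x : G) (a : A) (ξ : lp (fun _ : G => H) 2) :
    Summable fun s => ‖π (S.twist s x a) (ξ (s * x))‖ ^ 2 := by
  refine ((summable_sq_translate ξ x).mul_left (‖a‖ ^ 2)).of_nonneg_of_le (fun s => sq_nonneg _)
    fun s => ?_
  rw [← mul_pow]
  exact pow_le_pow_left₀ (norm_nonneg _) (S.norm_rep_twist_le π s x a _) 2

/-- The operator `(T ξ)(s) = π(α_s(a) ω(s, x)) ξ(s x)` on `ℓ²(G; H)`. -/
noncomputable def regularOp (x : G) (a : A) :
    lp (fun _ : G => H) 2 →L[ℂ] lp (fun _ : G => H) 2 :=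
  LinearMap.mkContinuous
    { toFun := fun ξ => ⟨fun s => π (S.twist s x a) (ξ (s * x)), by
        refine (memℓp_gen_iff (by simp)).2 ?_
        simpa using S.summable_sq_regular π x a ξ⟩
      map_add' := fun ξ η => by
        ext s
        exact map_add (π (S.twist s x a)) (ξ (s * x)) (η (s * x))
      map_smul' := fun c ξ => by
        ext s
        exact map_smul (π (S.twist s x a)) c (ξ (s * x)) } ‖a‖ fun ξ => by
    refine lp.norm_le_of_tsum_le (by simp) (by positivity) ?_
    simp only [ENNReal.toReal_ofNat, Real.rpow_ofNat]
    rw [mul_pow, ← tsum_sq_translate ξ x, ← tsum_mul_left]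
    refine (S.summable_sq_regular π x a ξ).tsum_le_tsum (fun s => ?_)
      ((summable_sq_translate ξ x).mul_left _)
    rw [← mul_pow]
    exact pow_le_pow_left₀ (norm_nonneg _) (S.norm_rep_twist_le π s x a _) 2

theorem regularOp_apply (x : G) (a : A) (ξ : lp (fun _ : G => H) 2) (s : G) :
    S.regularOp π x a ξ s = π (S.twist s x a) (ξ (s * x)) := rfl

theorem norm_regularOp_le (x : G) (a : A) : ‖S.regularOp π x a‖ ≤ ‖a‖ :=
  LinearMap.mkContinuous_norm_le _ (norm_nonneg a) _

/-- Test on the vector v placed at x: the value at the unit is π a v, as α_1 and ω(1, x) are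
trivial. -/
theorem norm_le_norm_regularOp (x : G) (a : A) {v : H} (hv : ‖v‖ = 1) :
    ‖π a v‖ ≤ ‖S.regularOp π x a‖ := by
  classical
  have h1 := (S.regularOp π x a).le_opNorm (lp.single 2 x v)
  rw [lp.norm_single (by simp), hv, mul_one] at h1
  refine le_trans ?_ h1
  have h2 := lp.norm_apply_le_norm (p := 2) (by simp) (S.regularOp π x a (lp.single 2 x v)) 1
  rwa [regularOp_apply, one_mul, lp.single_apply_self, twist_one] at h2

theorem regularOp_add (x : G) (a b : A) :
    S.regularOp π x (a + b) = S.regularOp π x a + S.regularOp π x b := by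
  ext ξ s
  simp [regularOp_apply]

theorem regularOp_smul (x : G) (c : ℂ) (a : A) :
    S.regularOp π x (c • a) = c • S.regularOp π x a := by
  ext ξ s
  simp [regularOp_apply]

theorem regularOp_mul (x z : G) (a b : A) : S.regularOp π x a * S.regularOp π z b =
    S.regularOp π (x * z) ((S.ω x z : 𝓜(ℂ, A)).snd (a * S.α x b)) := by
  ext ξ s
  rw [mul_apply_eq_comp, regularOp_apply, regularOp_apply, regularOp_apply,
    ← S.twist_mul, map_mul, mul_assoc]
  rfl

theorem star_regularOp (x : G) (a : A) : star (S.regularOp π x⁻¹ a) =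
    S.regularOp π x ((star (S.ω x x⁻¹ : 𝓜(ℂ, A))).fst (star (S.α x a))) := by
  symm
  rw [ContinuousLinearMap.star_eq_adjoint, ContinuousLinearMap.eq_adjoint_iff]
  intro ξ η
  rw [lp.inner_eq_tsum, lp.inner_eq_tsum]
  refine Eq.trans (tsum_congr fun s => ?_) ((Equiv.mulRight x).tsum_eq
    fun t => inner ℂ (ξ t) (S.regularOp π x⁻¹ a η t))
  rw [regularOp_apply, ← S.star_twist, map_star, ContinuousLinearMap.star_eq_adjoint,
    ContinuousLinearMap.adjoint_inner_left, regularOp_apply, Equiv.coe_mulRight]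
  rw [mul_inv_cancel_right]

end Representation

end TwistedCStarSystem

namespace TwistedCStarSystem

open MultiplierFacts

/-! ### Combining all representations into one isometric family. -/

section Product

variable {G A : Type*} [Group G] [NonUnitalCStarAlgebra A] (S : TwistedCStarSystem G A)
variable {ι : Type*} {H : ι → Type*} [∀ i, NormedAddCommGroup (H i)]
  [∀ i, InnerProductSpace ℂ (H i)] [∀ i, CompleteSpace (H i)]
  (π : ∀ i, A →⋆ₙₐ[ℂ] (H i →L[ℂ] H i))

/-- The bounded families of operators on the spaces `ℓ²(G; H i)`. -/
abbrev OperatorProduct (G : Type*) {ι : Type*} (H : ι → Type*) [∀ i, NormedAddCommGroup (H i)]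
    [∀ i, InnerProductSpace ℂ (H i)] : Type _ :=
  lp (fun i => lp (fun _ : G => H i) 2 →L[ℂ] lp (fun _ : G => H i) 2) ∞

/-- The C*-algebra structure on bounded families of operators. -/
noncomputable abbrev operatorProductAlgebra (G : Type*) {ι : Type*} (H : ι → Type*)
    [∀ i, NormedAddCommGroup (H i)] [∀ i, InnerProductSpace ℂ (H i)] [∀ i, CompleteSpace (H i)] :
    NonUnitalCStarAlgebra (OperatorProduct G H) := inferInstance

/-- The family of operators `regularOp` over a family of representations. -/
noncomputable def regular (x : G) : A →ₗ[ℂ] OperatorProduct G H where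
  toFun a := ⟨fun i => S.regularOp (π i) x a, memℓp_infty ⟨‖a‖, by
    rintro _ ⟨i, rfl⟩
    exact S.norm_regularOp_le (π i) x a⟩⟩
  map_add' a b := lp.ext (funext fun i => S.regularOp_add (π i) x a b)
  map_smul' c a := lp.ext (funext fun i => S.regularOp_smul (π i) x c a)

theorem norm_regular (hπ : ∀ a, a ≠ 0 → ∃ i, ∃ v : H i, ‖v‖ = 1 ∧ ‖π i a v‖ = ‖a‖)
    (x : G) (a : A) : ‖S.regular π x a‖ = ‖a‖ := by
  refine le_antisymm (lp.norm_le_of_forall_le (norm_nonneg a)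
    fun i => S.norm_regularOp_le (π i) x a) ?_
  rcases eq_or_ne a 0 with rfl | ha
  · simp
  · obtain ⟨i, v, hv, h⟩ := hπ a ha
    rw [← h]
    exact (S.norm_le_norm_regularOp (π i) x a hv).trans
      (lp.norm_apply_le_norm ENNReal.top_ne_zero (S.regular π x a) i)

theorem regular_mul (x z : G) (a b : A) : S.regular π x a * S.regular π z b =
    S.regular π (x * z) ((S.ω x z : 𝓜(ℂ, A)).snd (a * S.α x b)) :=
  lp.ext (funext fun i => S.regularOp_mul (π i) x z a b)

theorem star_regular (x : G) (a : A) : star (S.regular π x⁻¹ a) =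
    S.regular π x ((star (S.ω x x⁻¹ : 𝓜(ℂ, A))).fst (star (S.α x a))) :=
  lp.ext (funext fun i => S.star_regularOp (π i) x a)

end Product

/-! ### The homomorphism into the untwisted algebra. -/

section Hom

variable {G A C : Type*} [Group G] [NonUnitalCStarAlgebra A] [NonUnitalCStarAlgebra C]

/-- An isometric covariant family of linear maps `R x : A → C`: the products and adjoints are
those of the elementary functions `a δ_x` of the twisted crossed product. -/
structure IsometricFamily (S : TwistedCStarSystem G A) (C : Type*) [NonUnitalCStarAlgebra C] where
  R : G → A →ₗᵢ[ℂ] C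
  R_mul : ∀ x z a b, R x a * R z b = R (x * z) ((S.ω x z : 𝓜(ℂ, A)).snd (a * S.α x b))
  R_star : ∀ x a, star (R x⁻¹ a) = R x ((star (S.ω x x⁻¹ : 𝓜(ℂ, A))).fst (star (S.α x a)))

/-- The `*`-homomorphism from the twisted crossed product to an untwisted, unweighted
`ℓ¹`-algebra given by an isometric covariant family. -/
noncomputable def IsometricFamily.hom {S : TwistedCStarSystem G A} (F : IsometricFamily S C)
    (ν : SymmWeight G) : TwistedCrossedProduct S ν →⋆ₙₐ[ℂ]
      TwistedCrossedProduct (TwistedCStarSystem.trivial G C) (SymmWeight.trivial G) where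
  toFun f := ⟨fun x => F.R x (f x), by
    refine f.summable_norm.congr fun x => ?_
    change _ = 1 * ‖F.R x (f x)‖
    rw [one_mul, LinearIsometry.norm_map]⟩
  map_smul' c f := TwistedCrossedProduct.ext fun x => map_smul (F.R x) c (f x)
  map_zero' := TwistedCrossedProduct.ext fun x => map_zero (F.R x)
  map_add' f g := TwistedCrossedProduct.ext fun x => map_add (F.R x) (f x) (g x)
  map_mul' f g := TwistedCrossedProduct.ext fun x => by
    change F.R x ((f * g) x) = _
    rw [TwistedCrossedProduct.mul_apply, TwistedCrossedProduct.mul_apply]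
    refine ((F.R x).toContinuousLinearMap.map_tsum
      (TwistedCrossedProduct.summable_convTerm f g x)).trans (tsum_congr fun y => ?_)
    have h1 := F.R_mul y (y⁻¹ * x) (f y) (g (y⁻¹ * x))
    rw [mul_inv_cancel_left] at h1
    exact h1.symm
  map_star' f := TwistedCrossedProduct.ext fun x => by
    rw [TwistedCrossedProduct.star_apply]
    change F.R x ((star f) x) = (star (1 : 𝓜(ℂ, C))).fst (star (F.R x⁻¹ (f x⁻¹)))
    rw [star_one, F.R_star, TwistedCrossedProduct.star_apply]
    rfl

theorem IsometricFamily.norm_hom {S : TwistedCStarSystem G A} (F : IsometricFamily S C)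
    {ν : SymmWeight G} (k : TwistedCrossedProduct S ν) : ‖F.hom ν k‖ = ∑' x, ‖k x‖ := by
  rw [TwistedCrossedProduct.norm_def]
  refine tsum_congr fun x => ?_
  change 1 * ‖F.R x (k x)‖ = _
  rw [one_mul, LinearIsometry.norm_map]

end Hom

theorem exists_isometricFamily_of_representations {G : Type u} [Group G] {A : Type v}
    [NonUnitalCStarAlgebra A] (S : TwistedCStarSystem G A) {ι : Type v} {H : ι → Type v}
    [∀ i, NormedAddCommGroup (H i)] [∀ i, InnerProductSpace ℂ (H i)] [∀ i, CompleteSpace (H i)]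
    (π : ∀ i, A →⋆ₙₐ[ℂ] (H i →L[ℂ] H i))
    (hπ : ∀ a, a ≠ 0 → ∃ i, ∃ v : H i, ‖v‖ = 1 ∧ ‖π i a v‖ = ‖a‖) :
    ∃ (C : Type (max u v)) (_ : NonUnitalCStarAlgebra C), Nonempty (IsometricFamily S C) :=
  ⟨OperatorProduct G H, operatorProductAlgebra G H,
    ⟨⟨fun x => ⟨S.regular π x, S.norm_regular π hπ x⟩, S.regular_mul π, S.star_regular π⟩⟩⟩

/-- Every twisted system has an isometric covariant family, given by the regular representations
induced from the GNS representations. -/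
theorem exists_isometricFamily {G : Type u} [Group G] {A : Type v} [NonUnitalCStarAlgebra A]
    (S : TwistedCStarSystem G A) :
    ∃ (C : Type (max u v)) (_ : NonUnitalCStarAlgebra C), Nonempty (IsometricFamily S C) := by
  let _ := CStarAlgebra.spectralOrder (Unitization ℂ A)
  have _ := CStarAlgebra.spectralOrderedRing (Unitization ℂ A)
  open scoped ComplexOrder in
  let π : ∀ φ : Unitization ℂ A →ₚ[ℂ] ℂ, A →⋆ₙₐ[ℂ] (φ.GNS →L[ℂ] φ.GNS) := fun φ =>
    φ.gnsNonUnitalStarAlgHom.comp (Unitization.inrNonUnitalStarAlgHom ℂ A)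
  have hπ : ∀ a, a ≠ 0 → ∃ φ, ∃ v, ‖v‖ = 1 ∧ ‖π φ a v‖ = ‖a‖ := fun a ha => by
    obtain ⟨φ, v, hv, h⟩ := exists_gns_vector (a := (a : Unitization ℂ A))
      (fun h => ha (Unitization.inr_injective h))
    exact ⟨φ, v, hv, h.trans (Unitization.norm_inr ..)⟩
  exact S.exists_isometricFamily_of_representations π hπ

end TwistedCStarSystem

/-- For weights with subexponential word bounds, symmetry of the unweighted untwisted algebras
passes to weighted twisted crossed products. -/
theorem IsRigidlySymmetric.isSymmetric_twistedCrossedProduct {G : Type u} [Group G]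
    (hrig : IsRigidlySymmetric.{u, max u v} G) {ν : SymmWeight G}
    (hν : ν.HasSubexponentialWordBound) {A : Type v} [NonUnitalCStarAlgebra A]
    (S : TwistedCStarSystem G A) : IsSymmetricBanachStarAlgebra (TwistedCrossedProduct S ν) := by
  obtain ⟨C, _, ⟨F⟩⟩ := S.exists_isometricFamily
  refine (hrig C).of_hom (F.hom ν) fun k z hz => ?_
  rw [F.norm_hom]
  exact TwistedCrossedProduct.norm_le_tsum_norm_of_mem_quasispectrum hν hz

theorem mainTheorem8 {G : Type u} [Group G]
    (hrig : IsRigidlySymmetric.{u, max u v} G) (hamen : IsAmenableGroup G)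
    (ν : SymmWeight G) (V : Set G) (hone : (1 : G) ∈ V)
    (hgen : (⋃ n : ℕ, V ^ n) = Set.univ)
    (hugrs : Tendsto (fun n : ℕ => (⨆ x ∈ V ^ n, ENNReal.ofReal (ν x)) ^ (1 / (n : ℝ)))
      atTop (𝓝 1))
    (hcomp : ∃ C : ℝ≥0, ∀ n : ℕ,
      (⨆ x ∈ V ^ (n + 1) \ V ^ n, ENNReal.ofReal (ν x)) ≤
        (C : ℝ≥0∞) * ⨅ x ∈ V ^ (n + 1) \ V ^ n, ENNReal.ofReal (ν x))
    {A : Type v} [NonUnitalCStarAlgebra A] (S : TwistedCStarSystem G A) :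
    IsSymmetricBanachStarAlgebra (TwistedCrossedProduct S ν) := by
  exact hrig.isSymmetric_twistedCrossedProduct
    (SymmWeight.hasSubexponentialWordBound hone hgen hugrs hcomp) S
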